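/- Let $V=\bigcup_{n\in\omega}V_n$ be the standard universe, where $V_0=\mathbb N$ (the natural numbers are urelements) and $V_{n+1}=V_n\cup\mathcal P(V_n)$. A nonstandard universe ${}^*V$ is the truncation $\bigcup_{n\in\omega}{}^*V_n$, at ${}^*\!\in$-rank $\omega$, of an elementary extension of $(V,\in)$ such that ${}^*\mathbb N\setminus\mathbb N\neq\emptyset$; it is $\omega_1$-saturated if every countable family of internal sets with the finite intersection property has nonempty intersection. For $H\in{}^*\mathbb N\setminus\mathbb N$, the hyperfinite Loeb space $(\Omega,\Sigma,L_P)$ on $\Omega=\{1,2,\dots,H\}$ is the complete countably additive probability space generated by $\mathrm{st}\circ P$, where $P(A)={}^*|A|/H$ for each internal $A\subseteq\Omega$ and $\mathrm{st}$ is the standard part map. A probability space $(\Omega,\Sigma,P)$ is compact if there is a family $\mathcal C\subseteq\Sigma$ such that every $\mathcal D\subseteq\mathcal C$ with the finite intersection property satisfies $\bigcap\mathcal D\neq\emptyset$, and $P(A)=\sup\{P(C):C\subseteq A,\ C\in\mathcal C\}$ for every $A\in\Sigma$. Theorem. Let $\lambda$ be a cardinal with $\lambda>|V|$ and $\lambda^{\omega}=\lambda$.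 Then there exists an $\omega_1$-saturated nonstandard universe ${}^*V$ such that, for every $H\in{}^*\mathbb N\setminus\mathbb N$, the hyperfinite Loeb space on $\Omega=\{1,2,\dots,H\}$ satisfies $|\Omega|=\lambda$ and is not compact. -/

import Mathlib

open Cardinal MeasureTheory FirstOrder
open scoped ENNReal

universe u

/-! ### The standard universe: the superstructure over `ℕ`, with the naturals as urelements -/

/-- The `n`-th level `V_n`: `V_0 = ℕ` and `V_{n+1} = V_n ∪ 𝒫(V_n) = ℕ ∪ 𝒫(V_n)`. The second form
makes the union disjoint, as no natural number is a set. -/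
def Level : ℕ → Type
  | 0 => ℕ
  | n + 1 => ℕ ⊕ Set (Level n)

/-- A subset of `V_n`, as an element of `V_{n+1}`. -/
def Level.ofSet (n : ℕ) (s : Set (Level n)) : Level (n + 1) := Sum.inr s

/-- The inclusion `V_n ⊆ V_{n+1}`. -/
def Level.up : (n : ℕ) → Level n → Level (n + 1)
  | 0, k => Sum.inl k
  | _ + 1, Sum.inl k => Sum.inl k
  | n + 1, Sum.inr s => Level.ofSet (n + 1) (Level.up n '' s)

/-- The standard universe `V = ⋃ n, V_n`: the disjoint union of the levels, where each level is
identified with its copy inside the next one. -/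
def StdUniverse : Type :=
  Quot (fun a b : Σ n, Level n => b = ⟨a.1 + 1, Level.up a.1 a.2⟩)

namespace StdUniverse

/-- The element of `V` given by an element of `V_n`. -/
def mk (n : ℕ) (x : Level n) : StdUniverse := Quot.mk _ ⟨n, x⟩

/-- The natural number `k` as an urelement of `V`. -/
def atom (k : ℕ) : StdUniverse := mk 0 k

/-- The membership relation of `V`. -/
def Mem (v w : StdUniverse) : Prop :=
  ∃ (n : ℕ) (x : Level n) (s : Set (Level n)), v = mk n x ∧ w = mk (n + 1) (Level.ofSet n s) ∧ x ∈ s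

/-- The set `{v ∈ V_n | p v}`, an element of `V_{n+1}`. -/
def sep (n : ℕ) (p : StdUniverse → Prop) : StdUniverse :=
  mk (n + 1) (Level.ofSet n {x | p (mk n x)})

/-- The set `V_n`, as an element of `V_{n+1}`. -/
def levelSet (n : ℕ) : StdUniverse := sep n (fun _ => True)

end StdUniverse

/-- `z = {a, b}`, for a membership relation `E`. -/
def IsUPair {M : Type*} (E : M → M → Prop) (z a b : M) : Prop :=
  ∀ w, E w z ↔ w = a ∨ w = b

/-- `p` is the Kuratowski pair `(a, b) = {{a}, {a, b}}`, for a membership relation `E`. -/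
def IsOPair {M : Type*} (E : M → M → Prop) (p a b : M) : Prop :=
  ∀ z, E z p ↔ IsUPair E z a a ∨ IsUPair E z a b

namespace StdUniverse

/-- The set `𝒫(ℕ)`: the elements of `V_1` other than the urelements. -/
def powNat : StdUniverse := sep 1 (fun v => ∀ k, v ≠ atom k)

/-- A binary relation on `ℕ`, as a set of ordered pairs. -/
def natRel (R : ℕ → ℕ → Prop) : StdUniverse :=
  sep 2 (fun p => ∃ a b, R a b ∧ IsOPair Mem p (atom a) (atom b))

/-- A finite set of natural numbers, as an element of `V_1`. -/
def finSet (A : Finset ℕ) : StdUniverse := sep 0 (fun v => ∃ k ∈ A, v = atom k)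

/-- The cardinality function on the finite subsets of `ℕ`, as a set of ordered pairs. -/
def cardFun : StdUniverse :=
  sep 3 (fun p => ∃ A : Finset ℕ, IsOPair Mem p (finSet A) (atom A.card))

end StdUniverse

/-! ### Nonstandard universes -/

/-- The only symbol of the language of set theory. -/
inductive MemSymbol : ℕ → Type
  | mem : MemSymbol 2

/-- The first-order language `{∈}`. -/
def memLanguage : FirstOrder.Language.{0, 0} := ⟨fun _ => Empty, MemSymbol⟩

instance StdUniverse.memStructure : memLanguage.Structure StdUniverse where
  funMap := fun f => f.elim
  RelMap := fun r => match r with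
    | MemSymbol.mem => fun v => StdUniverse.Mem (v 0) (v 1)

/-- The interpretation of `∈` in a structure for the language `{∈}`. -/
def StructMem {M : Type*} [memLanguage.Structure M] (x y : M) : Prop :=
  FirstOrder.Language.Structure.RelMap (L := memLanguage) MemSymbol.mem ![x, y]

/-- The data defining a nonstandard universe: an elementary extension of the standard universe in
which `*ℕ ∖ ℕ` is not empty. The nonstandard universe itself is `NonstdUniverse.Carrier`. -/
structure NonstdUniverse where
  /-- The elementary extension, before truncation. -/
  Big : Type u
  /-- Its membership relation. -/
  [bigStructure : memLanguage.Structure Big]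
  /-- The elementary embedding of the standard universe. -/
  emb : StdUniverse ↪ₑ[memLanguage] Big
  /-- There is a nonstandard natural number. -/
  exists_nonstandard : ∃ x : Big, StructMem x (emb (StdUniverse.levelSet 0)) ∧
    ∀ k, x ≠ emb (StdUniverse.atom k)

attribute [instance] NonstdUniverse.bigStructure

namespace NonstdUniverse

/-- The nonstandard universe `*V = ⋃ n, *(V_n)`: the elementary extension truncated at rank `ω`. -/
def Carrier (U : NonstdUniverse.{u}) : Type u :=
  {x : U.Big // ∃ n, StructMem x (U.emb (StdUniverse.levelSet n))}

variable (U : NonstdUniverse.{u})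

/-- The membership relation `*∈` of `*V`. -/
def Mem (x y : U.Carrier) : Prop := StructMem x.1 y.1

theorem emb_mem_level (v : StdUniverse) :
    ∃ n, StructMem (U.emb v) (U.emb (StdUniverse.levelSet n)) := by
  induction v using Quot.ind with
  | mk a =>
    obtain ⟨n, x⟩ := a
    refine ⟨n, ?_⟩
    have h : FirstOrder.Language.Structure.RelMap (L := memLanguage) MemSymbol.mem
        ![StdUniverse.mk n x, StdUniverse.levelSet n] :=
      ⟨n, x, _, rfl, rfl, trivial⟩
    have h2 := (U.emb.map_rel MemSymbol.mem
      ![StdUniverse.mk n x, StdUniverse.levelSet n]).2 h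
    unfold StructMem
    convert h2 using 1
    funext i
    fin_cases i <;> rfl

/-- The map `v ↦ *v` from `V` to `*V`. -/
def star (v : StdUniverse) : U.Carrier := ⟨U.emb v, U.emb_mem_level v⟩

/-- `*V` is `ω₁`-saturated: a countable family of internal sets with the finite intersection
property has a common element. -/
def IsOmegaOneSaturated : Prop :=
  ∀ A : ℕ → U.Carrier, (∀ F : Finset ℕ, ∃ x, ∀ i ∈ F, U.Mem x (A i)) → ∃ x, ∀ i, U.Mem x (A i)

/-- `H` is a hyperfinite integer: `H ∈ *ℕ ∖ ℕ`. -/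
def IsHyperfinite (H : U.Carrier) : Prop :=
  U.Mem H (U.star (StdUniverse.levelSet 0)) ∧ ∀ k, H ≠ U.star (StdUniverse.atom k)

/-- `(x, y) ∈ *r`, for a set of pairs `r` in the standard universe. -/
def StarRel (r : StdUniverse) (x y : U.Carrier) : Prop :=
  ∃ p, IsOPair U.Mem p x y ∧ U.Mem p (U.star r)

/-- `Ω = {1, 2, …, H}`. -/
def Omega (H : U.Carrier) : Set U.Carrier :=
  {x | U.StarRel (StdUniverse.natRel fun a b => 1 ≤ a ∧ a ≤ b) x H}

/-- `*𝒫(Ω)`: the internal subsets of `Ω = {1, …, H}`, as elements of `*V`. -/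
def InternalSubsets (H : U.Carrier) : Set U.Carrier :=
  {A | U.Mem A (U.star StdUniverse.powNat) ∧ ∀ x, U.Mem x A → x ∈ U.Omega H}

/-- The set of points of `Ω = {1, …, H}` that belong to `A`. -/
def points (H A : U.Carrier) : Set (U.Omega H) := {x | U.Mem x.1 A}

/-- The standard part of `P(A) = *|A| / H`, as the supremum of the standard rationals `p / q` that
are `≤ *|A| / H`, that is, for which `p * H ≤ q * *|A|` holds in `*ℕ`. -/
noncomputable def stP (H A : U.Carrier) : ℝ :=
  sSup {r | ∃ p q : ℕ, 0 < q ∧ r = (p : ℝ) / q ∧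
    ∃ K, U.StarRel StdUniverse.cardFun A K ∧
      U.StarRel (StdUniverse.natRel fun a b => p * b ≤ q * a) K H}

/-- The set function `st ∘ P` on the internal subsets of `Ω`, extended by `∞` to the others. -/
noncomputable def preMeasure (H : U.Carrier) (S : Set (U.Omega H)) : ℝ≥0∞ :=
  ⨅ A ∈ U.InternalSubsets H, ⨅ _ : U.points H A = S, ENNReal.ofReal (U.stP H A)

/-- The outer measure `S ↦ inf ∑ st (P (Aₙ))` over countable covers of `S` by internal sets `Aₙ`. -/
noncomputable def loebOuter (H : U.Carrier) : OuterMeasure (U.Omega H) :=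
  OuterMeasure.boundedBy (U.preMeasure H)

/-- The Loeb `σ`-algebra `Σ`, as the Carathéodory measurable sets. For the finite measure `st ∘ P`
this is the completion of the `σ`-algebra generated by the internal sets. -/
@[reducible] noncomputable def loebSpace (H : U.Carrier) : MeasurableSpace (U.Omega H) :=
  (U.loebOuter H).caratheodory

/-- The Loeb measure `L_P` of the hyperfinite internal space on `Ω = {1, …, H}`. -/
noncomputable def loebMeasure (H : U.Carrier) : @Measure (U.Omega H) (U.loebSpace H) :=
  @OuterMeasure.toMeasure _ (U.loebSpace H) (U.loebOuter H) le_rfl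

end NonstdUniverse

/-! ### Compact probability spaces -/

/-- The finite intersection property. -/
def HasFIP {X : Type*} (D : Set (Set X)) : Prop :=
  ∀ F ⊆ D, F.Finite → (⋂₀ F).Nonempty

/-- A family of sets is compact if each subfamily with the finite intersection property has
nonempty intersection. -/
def IsCompactFamily {X : Type*} (C : Set (Set X)) : Prop :=
  ∀ D ⊆ C, HasFIP D → (⋂₀ D).Nonempty

/-- A measure space is compact if it has an inner-regular compact family of measurable sets. -/
def IsCompactMeasure {X : Type*} {m : MeasurableSpace X} (P : Measure X) : Prop :=
  ∃ C : Set (Set X), (∀ S ∈ C, MeasurableSet S) ∧ IsCompactFamily C ∧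
    ∀ A, MeasurableSet A → P A = ⨆ S ∈ C, ⨆ _ : S ⊆ A, P S

/-! A compact probability space cannot carry null sets `E α`, `α < 𝔠⁺`, such that every point lies
in `E α` for all large `α`. Indeed, an inner-regular compact family would supply a set `C α` of
positive measure inside the complement of each `E α`. Among `𝔠⁺` sets of positive measure,
unboundedly many have the finite intersection property (`exists_unbounded_inter_nonempty`), so
compactness gives a point common to unboundedly many `C α`, although that point is eventually in `E
α`. This is `not_isCompactMeasure_of_null_cover`.

The universe is built so that every `Ω` has such a cover. A sample point is a natural number
together with a function `ℕ → Finset ℕ` for each `j` in a well order `J`. By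
`exists_capturing_ultrafilter` some ultrafilter has the following property: if `h` is unlimited and
depends only on coordinates before `j`, then the `j`-th coordinate at `h` has cardinality
infinitesimal relative to `h`, yet contains the value of every numerical function depending only on
coordinates before `j`. Since coordinates take `h` as an argument, one ultrafilter serves all `H` at
once.

The functions with countable support form an elementary substructure of the ultrapower, and its
truncation is `ω₁`-saturated. Countable subsets of `J` are bounded, so each point of `Ω` is captured
by all late coordinates, and these give the null sets. Taking `J` to be the lexicographic product of
`𝔠⁺` and `λ` provides both the cofinality needed for the cover and enough indices for `|Ω| ≥ λ`; the
bound `|Ω| ≤ λ` is a count of functions with countable support. -/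

/-! ### Null covers and compactness of measures -/

/-- A well order of type `𝔠⁺`, up to the properties that matter: proper initial segments have at
most `𝔠` elements, and sets with at most `𝔠` elements are strictly bounded. -/
structure IsContinuumSuccLike (K : Type u) [LinearOrder K] : Prop where
  card_Iio_le : ∀ γ : K, #(Set.Iio γ) ≤ 𝔠
  exists_bound : ∀ S : Set K, #S ≤ 𝔠 → ∃ b, ∀ a ∈ S, a < b

theorem exists_bound_of_isRegular {c : Cardinal.{u}} (hc : c.IsRegular) (S : Set c.ord.ToType)
    (hS : #S < c) : ∃ b, ∀ a ∈ S, a < b := by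
  rw [← not_isCofinal_iff]
  intro h
  have h1 := Order.cof_le h
  rw [Ordinal.cof_toType, hc.cof_ord] at h1
  exact h1.not_gt hS

theorem isContinuumSuccLike_toType :
    IsContinuumSuccLike (Order.succ (𝔠 : Cardinal.{u})).ord.ToType where
  card_Iio_le γ := Order.lt_succ_iff.1 (by
    simpa using Cardinal.mk_Iio_lt γ (by simp))
  exists_bound S hS := exists_bound_of_isRegular (isRegular_succ aleph0_le_continuum) S
    (Order.lt_succ_iff.2 hS)

theorem IsContinuumSuccLike.exists_bound_range {K : Type u} [LinearOrder K]
    (hK : IsContinuumSuccLike K) {ι : Type u} (f : ι → K) (hι : #ι ≤ 𝔠) : ∃ b, ∀ i, f i < b := by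
  obtain ⟨b, hb⟩ := hK.exists_bound (Set.range f) (Cardinal.mk_range_le.trans hι)
  exact ⟨b, fun i => hb _ ⟨i, rfl⟩⟩

/-- The first uncountable well order. -/
abbrev OmegaOne : Type u := (ℵ₁ : Cardinal.{u}).ord.ToType

theorem countable_Iio_omegaOne (i : OmegaOne.{u}) : (Set.Iio i).Countable := by
  rw [← Cardinal.le_aleph0_iff_set_countable, ← Order.lt_succ_iff, succ_aleph0]
  simpa using Cardinal.mk_Iio_lt i (by simp)

theorem exists_bound_omegaOne (f : ℕ → OmegaOne.{u}) : ∃ b, ∀ n, f n < b := by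
  obtain ⟨b, hb⟩ := exists_bound_of_isRegular isRegular_aleph_one (Set.range f)
    ((Cardinal.le_aleph0_iff_set_countable.2 (Set.countable_range f)).trans_lt aleph0_lt_aleph_one)
  exact ⟨b, fun n => hb _ ⟨n, rfl⟩⟩

instance : Nonempty OmegaOne.{u} := by
  rw [← Cardinal.mk_ne_zero_iff, Cardinal.mk_ord_toType]
  exact (aleph_pos 1).ne'

/-- A pressing-down principle: if `q α` lies in one of the small sets `A γ`, `γ < α`, for every `α`
that is the limit of an increasing `ω₁`-sequence, then `q` is constant on an unbounded set. -/
theorem IsContinuumSuccLike.exists_unbounded_fiber {K : Type u} [LinearOrder K] [WellFoundedLT K]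
    (hK : IsContinuumSuccLike K) {T : Type u} (A : K → Set T)
    (hA : ∀ γ, #(A γ) ≤ 𝔠) (q : K → T)
    (hq : ∀ (φ : OmegaOne.{u} → K) (δ : K), StrictMono φ →
      (∀ i, φ i < δ) → (∀ γ < δ, ∃ i, γ < φ i) → ∃ i, q δ ∈ A (φ i)) :
    ∃ t, ∀ γ, ∃ α, γ ≤ α ∧ q α = t := by
  by_contra! hcon
  choose b hb using hcon
  -- If every fibre is bounded, then `g γ` can be taken beyond the bounds of all fibres over the
  -- small set `A γ`. An `ω₁`-sequence closed under `g` has a supremum `δ` at which `q δ`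
  -- contradicts the bound of its own fibre.
  have hg : ∀ γ, ∃ c, γ < c ∧ ∀ t ∈ A γ, b t < c := by
    intro γ
    obtain ⟨c, hc⟩ := hK.exists_bound_range (fun t : A γ => b t.1)
      (by simpa using hA γ)
    obtain ⟨d, hd⟩ := hK.exists_bound {γ} (by simpa using (nat_lt_continuum 1).le)
    exact ⟨max c d, lt_max_of_lt_right (hd γ rfl), fun t ht => lt_max_of_lt_left (hc ⟨t, ht⟩)⟩
  choose g hg1 hg2 using hg
  have hstep : ∀ (i : OmegaOne.{u}) (F : Set.Iio i → K),
      ∃ c, ∀ j, g (F j) < c := by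
    intro i F
    have : Countable (Set.Iio i) := (countable_Iio_omegaOne i).to_subtype
    exact hK.exists_bound_range (fun j => g (F j)) (Cardinal.mk_le_aleph0.trans aleph0_le_continuum)
  choose c hc using hstep
  let φ : OmegaOne.{u} → K :=
    WellFounded.fix (C := fun _ => K) (wellFounded_lt)
      (fun i F => c i (fun j => F j.1 j.2))
  have hφ : ∀ j i, j < i → g (φ j) < φ i := by
    intro j i hji
    have : φ i = c i (fun j => φ j.1) := WellFounded.fix_eq _ _ _
    rw [this]
    exact hc i (fun j => φ j.1) ⟨j, hji⟩
  have hmono : StrictMono φ := fun j i hji => (hg1 _).trans (hφ j i hji)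
  obtain ⟨d, hd⟩ := hK.exists_bound_range φ (by
    simpa using aleph_one_le_continuum)
  obtain ⟨δ, hδ, hδmin⟩ :=
    (wellFounded_lt (α := K)).has_min {d | ∀ i, φ i < d} ⟨d, hd⟩
  have hsucc : ∀ i : OmegaOne.{u}, ∃ j, i < j := by
    intro i
    obtain ⟨j, hj⟩ := exists_bound_omegaOne (fun _ => i)
    exact ⟨j, hj 0⟩
  have hlim : ∀ γ < δ, ∃ i, γ < φ i := by
    intro γ hγ
    by_contra! hcon
    refine hδmin γ ?_ hγ
    intro i
    obtain ⟨j, hj⟩ := hsucc i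
    exact (hmono hj).trans_le (hcon j)
  obtain ⟨i, hi⟩ := hq φ δ hmono hδ hlim
  obtain ⟨j, hj⟩ := hsucc i
  have h1 : b (q δ) ≤ δ := ((hg2 _ _ hi).trans (hφ i j hj)).le.trans (hδ j).le
  exact hb (q δ) δ h1 rfl

/-- `Q` is the set where the conditional expectation `f` of the indicator of `C` is positive. The
integral of `f` over `D ∩ Q` equals the measure of `D ∩ Q ∩ C`, and it is positive as soon as `D ∩
Q` is not null. -/
theorem exists_measurable_hull {X : Type*} {m m0 : MeasurableSpace X} (P : Measure X)
    [IsFiniteMeasure P] (hm : m ≤ m0) {C : Set X} (hC : MeasurableSet C) :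
    ∃ Q, MeasurableSet[m] Q ∧ (P C ≠ 0 → P Q ≠ 0) ∧
      ∀ D, MeasurableSet[m] D → P (D ∩ Q) ≠ 0 → P (D ∩ C) ≠ 0 := by
  set f := P[C.indicator (fun _ => (1 : ℝ))|m] with hf
  have hint : Integrable (C.indicator (fun _ => (1 : ℝ))) P :=
    (integrable_const 1).indicator hC
  have hfm : Measurable[m] f := stronglyMeasurable_condExp.measurable
  have hset : ∀ D, MeasurableSet[m] D → ∫ x in D, f x ∂P = P.real (D ∩ C) := by
    intro D hD
    rw [setIntegral_condExp hm hint hD, setIntegral_indicator hC]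
    simp [Measure.real]
  have hpos : ∀ D, MeasurableSet[m] D → P (D ∩ {x | 0 < f x}) ≠ 0 → P (D ∩ C) ≠ 0 := by
    intro D hD h h0
    have hQ : MeasurableSet[m] (D ∩ {x | 0 < f x}) :=
      hD.inter (measurableSet_lt measurable_const hfm)
    have h1 := hset _ hQ
    have h2 : P (D ∩ {x | 0 < f x} ∩ C) = 0 :=
      measure_mono_null (Set.inter_subset_inter_left C Set.inter_subset_left) h0
    rw [Measure.real, h2, ENNReal.toReal_zero] at h1
    have h3 : 0 < ∫ x in D ∩ {x | 0 < f x}, f x ∂P := by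
      rw [setIntegral_pos_iff_support_of_nonneg_ae]
      · refine pos_iff_ne_zero.2 fun h4 => h ?_
        refine measure_mono_null ?_ h4
        intro x hx
        exact ⟨ne_of_gt hx.2, hx⟩
      · filter_upwards [ae_restrict_mem (hm _ hQ)] with x hx using le_of_lt hx.2
      · exact integrable_condExp.integrableOn
    exact h3.ne' h1
  refine ⟨{x | 0 < f x}, measurableSet_lt measurable_const hfm, fun hC0 hQ0 => hC0 ?_, hpos⟩
  have h1 := hset Set.univ MeasurableSet.univ
  have h2 : f ≤ᵐ[P] 0 := by
    rw [Filter.EventuallyLE, ae_iff]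
    simpa using hQ0
  have h3 : ∫ x in Set.univ, f x ∂P ≤ 0 := by
    rw [setIntegral_univ]
    exact integral_nonpos_of_ae h2
  rw [h1, Set.univ_inter] at h3
  have h4 : P.real C = 0 := le_antisymm h3 measureReal_nonneg
  exact (measureReal_eq_zero_iff (measure_ne_top _ _)).1 h4

/-- `𝔠⁺` is a precaliber of finite measures. -/
theorem exists_unbounded_inter_nonempty {X K : Type u} [LinearOrder K] [WellFoundedLT K]
    (hK : IsContinuumSuccLike K) {m0 : MeasurableSpace X} (P : Measure X) [IsFiniteMeasure P]
    (C : K → Set X) (hC : ∀ α, MeasurableSet (C α)) (hpos : ∀ α, P (C α) ≠ 0) :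
    ∃ S : Set K, (∀ γ, ∃ α ∈ S, γ ≤ α) ∧
      ∀ F : Finset K, ↑F ⊆ S → (⋂ α ∈ F, C α).Nonempty := by
  let Sg : K → MeasurableSpace X := fun α => MeasurableSpace.generateFrom (C '' Set.Iio α)
  have hm : ∀ α, Sg α ≤ m0 := by
    intro α
    refine MeasurableSpace.generateFrom_le ?_
    rintro _ ⟨β, _, rfl⟩
    exact hC β
  have hmono : Monotone Sg := fun α β h =>
    MeasurableSpace.generateFrom_mono (Set.image_mono (Set.Iio_subset_Iio h))
  choose Q hQm hQ0 hQ using fun α => exists_measurable_hull P (hm α) (hC α)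
  obtain ⟨t, ht⟩ := hK.exists_unbounded_fiber (fun γ => {s | MeasurableSet[Sg γ] s})
    (fun γ => MeasurableSpace.cardinal_measurableSet_le_continuum
      ((Cardinal.mk_image_le).trans (hK.card_Iio_le γ))) Q (by
    intro φ δ hφ _ hlim
    -- At a limit of an `ω₁`-sequence, the union of the earlier σ-algebras is already closed under
    -- countable unions, because countably many indices below `ω₁` are bounded.
    have key : ∀ s, MeasurableSet[Sg δ] s → ∃ i, MeasurableSet[Sg (φ i)] s := by
      intro s hs
      induction s, hs using MeasurableSpace.generateFrom_induction with
      | hC s hs _ =>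
        obtain ⟨β, hβ, rfl⟩ := hs
        obtain ⟨i, hi⟩ := hlim β hβ
        exact ⟨i, MeasurableSpace.measurableSet_generateFrom ⟨β, hi, rfl⟩⟩
      | empty =>
        exact ⟨Classical.arbitrary _, MeasurableSpace.measurableSet_empty _⟩
      | compl s _ ih =>
        obtain ⟨i, hi⟩ := ih
        exact ⟨i, MeasurableSpace.measurableSet_compl _ _ hi⟩
      | iUnion s _ ih =>
        choose i hi using ih
        obtain ⟨b, hb⟩ := exists_bound_omegaOne i
        exact ⟨b, MeasurableSpace.measurableSet_iUnion _ _
          (fun n => hmono (hφ.monotone (hb n).le) _ (hi n))⟩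
    exact key _ (hQm δ))
  refine ⟨{α | Q α = t}, fun γ => ?_, ?_⟩
  · obtain ⟨α, h1, h2⟩ := ht γ
    exact ⟨α, h2, h1⟩
  obtain ⟨α₀, hα₀⟩ : ∃ α, Q α = t := by
    obtain ⟨γ, -⟩ := hK.exists_bound ∅ (by simp)
    obtain ⟨α, -, h⟩ := ht γ
    exact ⟨α, h⟩
  -- Indices are added in increasing order. The intersection so far is measurable for `Sg a` and
  -- contained in `t = Q a`, so the hull property keeps it non-null after intersecting with `C a`.
  have hfin : ∀ F : Finset K, ↑F ⊆ {α | Q α = t} → P (t ∩ ⋂ α ∈ F, C α) ≠ 0 := by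
    intro F
    induction F using Finset.induction_on_max with
    | empty =>
      intro _
      simpa [hα₀] using hQ0 α₀ (hpos α₀)
    | insert a F hF ih =>
      intro hsub
      have ha : Q a = t := hsub (by simp)
      have ih' := ih (fun x hx => hsub (by simp at hx ⊢; exact Or.inr hx))
      have hD : MeasurableSet[Sg a] (t ∩ ⋂ α ∈ F, C α) := by
        refine MeasurableSet.inter (m := Sg a) (ha ▸ hQm a) ?_
        refine MeasurableSet.biInter (m := Sg a) F.countable_toSet fun β hβ => ?_
        exact MeasurableSpace.measurableSet_generateFrom ⟨β, hF β hβ, rfl⟩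
      have h1 := hQ a _ hD (by
        rw [ha]
        rwa [Set.inter_eq_left.2 Set.inter_subset_left])
      convert h1 using 2
      ext x
      simp only [Finset.mem_insert, Set.mem_inter_iff, Set.mem_iInter, forall_eq_or_imp]
      tauto
  intro F hF
  exact (nonempty_of_measure_ne_zero (hfin F hF)).mono Set.inter_subset_right

/-- A finite measure is not compact if the space is covered by null sets `E α`, `α < 𝔠⁺`, such that
each point belongs to all `E α` from some index on. -/
theorem not_isCompactMeasure_of_null_cover {X K : Type u} [LinearOrder K] [WellFoundedLT K]
    (hK : IsContinuumSuccLike K) {m0 : MeasurableSpace X} (P : Measure X) [IsFiniteMeasure P]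
    (hP : P Set.univ ≠ 0) (E : K → Set X) (hEm : ∀ α, MeasurableSet (E α))
    (hE : ∀ α, P (E α) = 0) (hcover : ∀ x, ∃ γ, ∀ α, γ ≤ α → x ∈ E α) :
    ¬ IsCompactMeasure P := by
  rintro ⟨𝒞, hm, hcomp, hreg⟩
  have hex : ∀ α, ∃ S ∈ 𝒞, S ⊆ (E α)ᶜ ∧ P S ≠ 0 := by
    intro α
    by_contra! hcon
    have h1 := hreg _ (hEm α).compl
    have h2 : P (E α)ᶜ = 0 := by
      rw [h1]
      simp only [ENNReal.iSup_eq_zero]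
      exact hcon
    exact hP (by rw [← Set.union_compl_self (E α)]; exact measure_union_null (hE α) h2)
  choose C hC𝒞 hCE hCpos using hex
  obtain ⟨S, hS, hfin⟩ := exists_unbounded_inter_nonempty hK P C (fun α => hm _ (hC𝒞 α)) hCpos
  obtain ⟨x, hx⟩ := hcomp (C '' S) (by rintro _ ⟨α, _, rfl⟩; exact hC𝒞 α) (by
    intro F hF hFfin
    obtain ⟨G, hG, hGfin, rfl⟩ := Set.exists_subset_image_finite_and.1 ⟨F, hF, hFfin, rfl⟩
    obtain ⟨y, hy⟩ := hfin hGfin.toFinset (by simpa using hG)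
    refine ⟨y, ?_⟩
    simp only [Set.sInter_image, Set.mem_iInter]
    intro α hα
    simp only [Set.mem_iInter, Set.Finite.mem_toFinset] at hy
    exact hy α hα)
  obtain ⟨γ, hγ⟩ := hcover x
  obtain ⟨α, hα, hle⟩ := hS γ
  exact hCE α (hx _ ⟨α, hα, rfl⟩) (hγ α hle)

/-! ### Set theory inside the standard universe -/

/-- The ordered pair determines its components, if enough unordered pairs exist. -/
theorem IsOPair.inj {M : Type*} {E : M → M → Prop} {p a b a' b' : M} (h : IsOPair E p a b)
    (h' : IsOPair E p a' b') (h1 : ∃ z, IsUPair E z a a) (h2 : ∃ z, IsUPair E z a b)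
    (h3 : ∃ z, IsUPair E z a' b') : a = a' ∧ b = b' := by
  obtain ⟨z1, h1⟩ := h1
  obtain ⟨z2, h2⟩ := h2
  obtain ⟨z3, h3⟩ := h3
  have e1 := (h' z1).1 ((h z1).2 (Or.inl h1))
  have e2 := (h' z2).1 ((h z2).2 (Or.inr h2))
  have e3 := (h z3).1 ((h' z3).2 (Or.inr h3))
  have ha : a = a' := by
    rcases e1 with e | e
    · simpa using (e a).1 ((h1 a).2 (Or.inl rfl))
    · exact (by simpa using (h1 a').1 ((e a').2 (Or.inl rfl)) : a' = a).symm
  subst ha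
  refine ⟨rfl, ?_⟩
  have hb : b = a ∨ b = b' := by
    rcases e2 with e | e
    · have := (e b).1 ((h2 b).2 (Or.inr rfl)); tauto
    · have := (e b).1 ((h2 b).2 (Or.inr rfl)); tauto
  have hb' : b' = a ∨ b' = b := by
    rcases e3 with e | e
    · have := (e b').1 ((h3 b').2 (Or.inr rfl)); tauto
    · have := (e b').1 ((h3 b').2 (Or.inr rfl)); tauto
  rcases hb with rfl | hb
  · rcases hb' with hb' | hb'
    · exact hb'.symm
    · exact hb'.symm
  · exact hb

/-! ### Representatives in the levels, extensionality and coded relations. -/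

theorem Level.up_injective : ∀ n, Function.Injective (Level.up n)
  | 0 => fun _ _ h => Sum.inl_injective h
  | n + 1 => by
    intro x y h
    rcases x with k | s <;> rcases y with l | t
    · exact congrArg Sum.inl (Sum.inl_injective h)
    · exact absurd h Sum.inl_ne_inr
    · exact absurd h Sum.inr_ne_inl
    · exact congrArg Sum.inr ((Level.up_injective n).image_injective (Sum.inr_injective h))

namespace StdUniverse

/-- The inclusion of each level into the next one, on the disjoint union of all levels. -/
def step (a : Σ n, Level n) : Σ n, Level n := ⟨a.1 + 1, Level.up a.1 a.2⟩

theorem step_injective : Function.Injective step := by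
  rintro ⟨n, x⟩ ⟨m, y⟩ h
  have h1 : n = m := by
    have := congrArg Sigma.fst h
    simpa [step] using this
  subst h1
  have h2 : Level.up n x = Level.up n y := by
    simpa [step] using h
  rw [Level.up_injective n h2]

theorem step_iterate_fst (k : ℕ) (a : Σ n, Level n) : (step^[k] a).1 = a.1 + k := by
  induction k with
  | zero => rfl
  | succ k ih => rw [Function.iterate_succ_apply', ← Nat.add_assoc, ← ih]; rfl

/-- Two representatives of the same element merge after finitely many inclusions. Injectivity of
`step` then makes representatives within a fixed level unique. -/
theorem exists_iterate_step_eq {a b : Σ n, Level n}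
    (h : (Quot.mk _ a : StdUniverse) = Quot.mk _ b) : ∃ k l, step^[k] a = step^[l] b := by
  replace h := Quot.eqvGen_exact h
  induction h with
  | rel a b h => exact ⟨1, 0, h.symm⟩
  | refl a => exact ⟨0, 0, rfl⟩
  | symm a b _ ih =>
    obtain ⟨k, l, h⟩ := ih
    exact ⟨l, k, h.symm⟩
  | trans a b c _ _ ih1 ih2 =>
    obtain ⟨k, l, h1⟩ := ih1
    obtain ⟨m, n, h2⟩ := ih2
    refine ⟨m + k, l + n, ?_⟩
    rw [Function.iterate_add_apply, h1, ← Function.iterate_add_apply, Nat.add_comm m l,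
      Function.iterate_add_apply, h2, ← Function.iterate_add_apply]

theorem mk_injective (n : ℕ) : Function.Injective (mk n) := by
  intro x y h
  obtain ⟨k, l, h⟩ := exists_iterate_step_eq h
  have h1 := congrArg Sigma.fst h
  rw [step_iterate_fst, step_iterate_fst] at h1
  obtain rfl : k = l := by simpa using h1
  simpa using step_injective.iterate k h

theorem mk_up (n : ℕ) (x : Level n) : mk (n + 1) (Level.up n x) = mk n x := by
  symm
  apply Quot.sound
  rfl

theorem mk_inl (n k : ℕ) : mk (n + 1) (Sum.inl k) = atom k := by
  induction n with
  | zero => exact mk_up 0 k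
  | succ n ih => rw [← ih]; exact mk_up (n + 1) (Sum.inl k)

theorem atom_injective : Function.Injective atom := mk_injective 0

theorem range_mk_mono {n m : ℕ} (h : n ≤ m) : Set.range (mk n) ⊆ Set.range (mk m) := by
  induction m, h using Nat.le_induction with
  | base => exact subset_rfl
  | succ m _ ih =>
    refine ih.trans ?_
    rintro _ ⟨x, rfl⟩
    exact ⟨_, mk_up m x⟩

theorem exists_mem_range_mk (v : StdUniverse) : ∃ n, v ∈ Set.range (mk n) := by
  induction v using Quot.ind with
  | mk a => exact ⟨a.1, a.2, rfl⟩

theorem exists_ofSet_of_le {n m : ℕ} (h : n ≤ m) (s : Set (Level n)) :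
    ∃ t : Set (Level m), mk (m + 1) (Level.ofSet m t) = mk (n + 1) (Level.ofSet n s) ∧
      mk m '' t = mk n '' s := by
  induction m, h using Nat.le_induction with
  | base => exact ⟨s, rfl, rfl⟩
  | succ m _ ih =>
    obtain ⟨t, h1, h2⟩ := ih
    refine ⟨Level.up m '' t, ?_, ?_⟩
    · rw [← h1]; exact mk_up (m + 1) (Sum.inr t)
    · rw [← h2, Set.image_image]
      simp only [mk_up]

/-- Extensionality: both sets are raised to a common level, where `mk` is injective. -/
theorem ofSet_eq_iff {n m : ℕ} (s : Set (Level n)) (t : Set (Level m)) :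
    mk (n + 1) (Level.ofSet n s) = mk (m + 1) (Level.ofSet m t) ↔ mk n '' s = mk m '' t := by
  obtain ⟨s', hs1, hs2⟩ := exists_ofSet_of_le (le_max_left n m) s
  obtain ⟨t', ht1, ht2⟩ := exists_ofSet_of_le (le_max_right n m) t
  rw [← hs1, ← ht1, ← hs2, ← ht2, (mk_injective _).eq_iff, (mk_injective _).image_injective.eq_iff]
  exact Sum.inr_injective.eq_iff

theorem mem_ofSet {v : StdUniverse} {n : ℕ} {s : Set (Level n)} :
    Mem v (mk (n + 1) (Level.ofSet n s)) ↔ v ∈ mk n '' s := by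
  constructor
  · rintro ⟨m, x, t, rfl, h, hx⟩
    rw [(ofSet_eq_iff s t).1 h]
    exact ⟨x, hx, rfl⟩
  · rintro ⟨x, hx, rfl⟩
    exact ⟨n, x, s, rfl, rfl, hx⟩

theorem mem_sep {v : StdUniverse} {n : ℕ} {p : StdUniverse → Prop} :
    Mem v (sep n p) ↔ v ∈ Set.range (mk n) ∧ p v := by
  rw [sep, mem_ofSet]
  constructor
  · rintro ⟨x, hx, rfl⟩
    exact ⟨⟨x, rfl⟩, hx⟩
  · rintro ⟨⟨x, rfl⟩, hx⟩
    exact ⟨x, hx, rfl⟩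

theorem mem_levelSet {v : StdUniverse} {n : ℕ} : Mem v (levelSet n) ↔ v ∈ Set.range (mk n) := by
  simp [levelSet, mem_sep]

theorem mem_levelSet_zero {v : StdUniverse} : Mem v (levelSet 0) ↔ ∃ k, v = atom k := by
  rw [mem_levelSet]
  exact ⟨fun ⟨k, h⟩ => ⟨k, h.symm⟩, fun ⟨k, h⟩ => ⟨k, h.symm⟩⟩

theorem not_mem_atom (v : StdUniverse) (k : ℕ) : ¬ Mem v (atom k) := by
  rintro ⟨n, x, s, -, h, -⟩
  rw [← mk_inl n k] at h
  exact Sum.inl_ne_inr (mk_injective _ h)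

/-- An element of a level is a natural number or a set of elements of the previous level. -/
theorem eq_atom_or_eq_ofSet {v : StdUniverse} {n : ℕ} (h : v ∈ Set.range (mk n)) :
    (∃ k, v = atom k) ∨ ∃ (m : ℕ) (s : Set (Level m)), m + 1 = n ∧
      v = mk (m + 1) (Level.ofSet m s) := by
  obtain ⟨x, rfl⟩ := h
  cases n with
  | zero => exact Or.inl ⟨x, rfl⟩
  | succ n =>
    rcases x with k | s
    · exact Or.inl ⟨k, mk_inl n k⟩
    · exact Or.inr ⟨n, s, rfl, rfl⟩

theorem mem_range_mk_of_mem {v w : StdUniverse} {n : ℕ} (h : Mem v w)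
    (hw : w ∈ Set.range (mk n)) : v ∈ Set.range (mk n) := by
  rcases eq_atom_or_eq_ofSet hw with ⟨k, rfl⟩ | ⟨m, s, rfl, rfl⟩
  · exact absurd h (not_mem_atom v k)
  · obtain ⟨x, -, rfl⟩ := mem_ofSet.1 h
    exact range_mk_mono (Nat.le_succ m) ⟨x, rfl⟩

theorem mem_range_mk_succ {w : StdUniverse} {n : ℕ} (hne : ∃ v, Mem v w)
    (hw : ∀ v, Mem v w → v ∈ Set.range (mk n)) : w ∈ Set.range (mk (n + 1)) := by
  obtain ⟨m, hm⟩ := exists_mem_range_mk w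
  rcases eq_atom_or_eq_ofSet hm with ⟨k, rfl⟩ | ⟨m, s, rfl, rfl⟩
  · exact absurd hne.choose_spec (not_mem_atom _ k)
  · refine ⟨Level.ofSet n {x | mk n x ∈ mk m '' s}, (ofSet_eq_iff _ _).2 ?_⟩
    ext v
    constructor
    · rintro ⟨x, hx, rfl⟩
      exact hx
    · intro hv
      obtain ⟨x, rfl⟩ := hw v (mem_ofSet.2 hv)
      exact ⟨x, hv, rfl⟩

theorem exists_isUPair (v w : StdUniverse) : ∃ z, IsUPair Mem z v w := by
  obtain ⟨n, hn⟩ := exists_mem_range_mk v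
  obtain ⟨m, hm⟩ := exists_mem_range_mk w
  refine ⟨sep (max n m) (fun x => x = v ∨ x = w), fun x => ?_⟩
  rw [mem_sep]
  refine ⟨fun h => h.2, fun h => ⟨?_, h⟩⟩
  rcases h with rfl | rfl
  · exact range_mk_mono (le_max_left _ _) hn
  · exact range_mk_mono (le_max_right _ _) hm

theorem IsUPair.mem_range_mk {z v w : StdUniverse} {n : ℕ} (h : IsUPair Mem z v w)
    (hv : v ∈ Set.range (mk n)) (hw : w ∈ Set.range (mk n)) : z ∈ Set.range (mk (n + 1)) := by
  refine mem_range_mk_succ ⟨v, (h v).2 (Or.inl rfl)⟩ fun x hx => ?_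
  rcases (h x).1 hx with rfl | rfl <;> assumption

theorem IsOPair.mem_range_mk {p v w : StdUniverse} {n : ℕ} (h : IsOPair Mem p v w)
    (hv : v ∈ Set.range (mk n)) (hw : w ∈ Set.range (mk n)) : p ∈ Set.range (mk (n + 2)) := by
  obtain ⟨z, hz⟩ := exists_isUPair v w
  refine mem_range_mk_succ ⟨z, (h z).2 (Or.inr hz)⟩ fun x hx => ?_
  rcases (h x).1 hx with h | h
  · exact IsUPair.mem_range_mk h hv hv
  · exact IsUPair.mem_range_mk h hv hw

theorem exists_isOPair (v w : StdUniverse) : ∃ p, IsOPair Mem p v w := by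
  obtain ⟨n, hn⟩ := exists_mem_range_mk v
  obtain ⟨m, hm⟩ := exists_mem_range_mk w
  have hn' := range_mk_mono (le_max_left n m) hn
  have hm' := range_mk_mono (le_max_right n m) hm
  refine ⟨sep (max n m + 1) (fun z => IsUPair Mem z v v ∨ IsUPair Mem z v w), fun z => ?_⟩
  rw [mem_sep]
  refine ⟨fun h => h.2, fun h => ⟨?_, h⟩⟩
  rcases h with h | h
  · exact IsUPair.mem_range_mk h hn' hn'
  · exact IsUPair.mem_range_mk h hn' hm'

theorem isOPair_inj {p a b a' b' : StdUniverse} (h : IsOPair Mem p a b)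
    (h' : IsOPair Mem p a' b') : a = a' ∧ b = b' :=
  h.inj h' (exists_isUPair _ _) (exists_isUPair _ _) (exists_isUPair _ _)

/-- A set of natural numbers, as an element of `V`. -/
def natSet (A : Set ℕ) : StdUniverse := mk 1 (Level.ofSet 0 A)

theorem mem_natSet {v : StdUniverse} {A : Set ℕ} : Mem v (natSet A) ↔ ∃ k ∈ A, v = atom k := by
  refine mem_ofSet.trans ?_
  exact ⟨fun ⟨k, h, e⟩ => ⟨k, h, e.symm⟩, fun ⟨k, h, e⟩ => ⟨k, h, e.symm⟩⟩

theorem atom_mem_natSet {k : ℕ} {A : Set ℕ} : Mem (atom k) (natSet A) ↔ k ∈ A := by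
  rw [mem_natSet]
  exact ⟨fun ⟨l, h, e⟩ => atom_injective e ▸ h, fun h => ⟨k, h, rfl⟩⟩

theorem natSet_injective : Function.Injective natSet := by
  intro A B h
  ext k
  rw [← atom_mem_natSet, h, atom_mem_natSet]

theorem finSet_eq (A : Finset ℕ) : finSet A = natSet ↑A := by
  refine (ofSet_eq_iff _ _).2 (congrArg _ ?_)
  ext k
  exact ⟨fun ⟨l, h, e⟩ => mk_injective 0 e ▸ h, fun h => ⟨k, h, rfl⟩⟩

theorem finSet_injective : Function.Injective finSet := by
  intro A B h
  rw [finSet_eq, finSet_eq] at h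
  exact Finset.coe_injective (natSet_injective h)

theorem mem_powNat {v : StdUniverse} : Mem v powNat ↔ ∃ A, v = natSet A := by
  rw [powNat, mem_sep]
  constructor
  · rintro ⟨h, hv⟩
    rcases eq_atom_or_eq_ofSet h with ⟨k, rfl⟩ | ⟨m, s, hm, rfl⟩
    · exact absurd rfl (hv k)
    · obtain rfl : m = 0 := by simpa using hm
      exact ⟨s, rfl⟩
  · rintro ⟨A, rfl⟩
    refine ⟨⟨_, rfl⟩, fun k h => ?_⟩
    rw [← mk_inl 0 k] at h
    exact Sum.inr_ne_inl (mk_injective _ h)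

theorem mem_natRel_of_isOPair {p a b : StdUniverse} {R : ℕ → ℕ → Prop} (h : IsOPair Mem p a b) :
    Mem p (natRel R) ↔ ∃ k l, R k l ∧ a = atom k ∧ b = atom l := by
  rw [natRel, mem_sep]
  constructor
  · rintro ⟨-, k, l, hR, h'⟩
    exact ⟨k, l, hR, isOPair_inj h h'⟩
  · rintro ⟨k, l, hR, rfl, rfl⟩
    exact ⟨IsOPair.mem_range_mk h ⟨k, rfl⟩ ⟨l, rfl⟩, k, l, hR, h⟩

theorem mem_cardFun_of_isOPair {p a b : StdUniverse} (h : IsOPair Mem p a b) :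
    Mem p cardFun ↔ ∃ A : Finset ℕ, a = finSet A ∧ b = atom A.card := by
  rw [cardFun, mem_sep]
  constructor
  · rintro ⟨-, A, h'⟩
    exact ⟨A, isOPair_inj h h'⟩
  · rintro ⟨A, rfl, rfl⟩
    exact ⟨IsOPair.mem_range_mk h ⟨_, rfl⟩ (range_mk_mono zero_le_one ⟨_, rfl⟩), A, h⟩

/-- A subset of `V` is determined by the sequence of its intersections with the levels, and each of
these is an element of `V`. -/
theorem two_pow_le : 2 ^ #StdUniverse ≤ #StdUniverse ^ ℵ₀ := by
  rw [← Cardinal.mk_set, ← Cardinal.mk_nat, Cardinal.power_def]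
  refine Cardinal.mk_le_of_injective (f := fun A n => sep n (fun v => v ∈ A)) ?_
  intro A B h
  ext v
  obtain ⟨n, hn⟩ := exists_mem_range_mk v
  have h1 := mem_sep (v := v) (n := n) (p := fun v => v ∈ A)
  have h2 := mem_sep (v := v) (n := n) (p := fun v => v ∈ B)
  have h3 : sep n (fun v => v ∈ A) = sep n (fun v => v ∈ B) := congrFun h n
  rw [h3] at h1
  tauto

theorem continuum_le : 𝔠 ≤ #StdUniverse := by
  rw [← Cardinal.mk_set_nat]
  exact Cardinal.mk_le_of_injective natSet_injective

end StdUniverse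

/-! ### An ultrafilter capturing many functions -/

/-- The index set of the limit ultrapower: a natural number and a `J`-indexed family of functions
from natural numbers to finite sets of natural numbers. -/
abbrev SamplePoint (J : Type u) : Type u := ℕ × (J → ℕ → Finset ℕ)

/-- The value of `f` depends only on the natural number and the coordinates in `s`. -/
def SupportedOn {J : Type u} {α : Type*} (f : SamplePoint J → α) (s : Set J) : Prop :=
  ∀ x y : SamplePoint J, x.1 = y.1 → (∀ j ∈ s, x.2 j = y.2 j) → f x = f y

section Capture

open Filter Classical

variable {J : Type u} [LinearOrder J]

/-- Replace all coordinates from `j` on by the default value. -/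
noncomputable def truncate (j : J) (x : SamplePoint J) : SamplePoint J :=
  (x.1, fun i => if i < j then x.2 i else default)

theorem truncate_truncate {i j : J} (h : i ≤ j) (x : SamplePoint J) :
    truncate i (truncate j x) = truncate i x := by
  refine Prod.ext rfl (funext fun l => ?_)
  by_cases hl : l < i
  · simp [truncate, hl, hl.trans_le h]
  · simp [truncate, hl]

theorem truncate_comp_truncate {i j : J} (h : i ≤ j) :
    (truncate i ∘ truncate j : SamplePoint J → SamplePoint J) = truncate i :=
  funext (truncate_truncate h)

theorem SupportedOn.truncate_eq {α : Type*} {f : SamplePoint J → α} {j : J}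
    (hf : SupportedOn f (Set.Iio j)) (x : SamplePoint J) : f (truncate j x) = f x :=
  hf _ _ rfl fun i hi => by simp [truncate, Set.mem_Iio.1 hi]

/-- The `j`-th coordinate, as a set at the argument `h`, contains the value of `x` and is small
compared with `h`. The triple `p` is `(x, h, n)`. -/
def captureSet (j : J) (p : (SamplePoint J → ℕ) × (SamplePoint J → ℕ) × ℕ) :
    Set (SamplePoint J) :=
  {ω | p.1 ω ∈ ω.2 j (p.2.1 ω) ∧ p.2.2 * (ω.2 j (p.2.1 ω)).card ≤ p.2.1 ω}

/-- The triples `(x, h, n)` that the `j`-th coordinate has to capture. -/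
def captureData (j : J) (D : Filter (SamplePoint J)) :
    Set ((SamplePoint J → ℕ) × (SamplePoint J → ℕ) × ℕ) :=
  {p | SupportedOn p.1 (Set.Iio j) ∧ SupportedOn p.2.1 (Set.Iio j) ∧ Tendsto p.2.1 D atTop}

/-- The part of `D` that concerns the coordinates below `j`, and the requirements on the `j`-th
coordinate. -/
noncomputable def captureFilter (j : J) (D : Filter (SamplePoint J)) : Filter (SamplePoint J) :=
  ⨅ F : {F : Finset ((SamplePoint J → ℕ) × (SamplePoint J → ℕ) × ℕ) // ↑F ⊆ captureData j D},
    comap (truncate j) (map (truncate j) D) ⊓ 𝓟 (⋂ p ∈ F.1, captureSet j p)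

/-- Finitely many requirements are met by overwriting the `j`-th coordinate with the finite set of
values to be captured. Nothing below `j` changes, and an unlimited `h` eventually exceeds any fixed
multiple of the number of requirements. -/
theorem captureFilter_neBot (j : J) (D : Filter (SamplePoint J)) [D.NeBot] :
    (captureFilter j D).NeBot := by
  have : Nonempty {F : Finset ((SamplePoint J → ℕ) × (SamplePoint J → ℕ) × ℕ) //
      ↑F ⊆ captureData j D} := ⟨⟨∅, by simp⟩⟩
  refine iInf_neBot_of_directed' ?_ ?_
  · intro F G
    refine ⟨⟨F.1 ∪ G.1, by simpa using ⟨F.2, G.2⟩⟩, ?_, ?_⟩ <;>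
    · refine inf_le_inf_left _ (principal_mono.2 ?_)
      refine Set.biInter_subset_biInter_left fun p hp => ?_
      simp only [Finset.mem_coe, Finset.mem_union] at hp ⊢
      tauto
  · rintro ⟨F, hF⟩
    rw [inf_principal_neBot_iff]
    rintro U ⟨B, hB, hBU⟩
    have h1 : ∀ᶠ ω in D, ∀ p ∈ F, p.2.2 * F.card ≤ p.2.1 ω := by
      rw [eventually_all_finset]
      exact fun p hp => (hF hp).2.2.eventually_ge_atTop _
    obtain ⟨ω, hω, hωB⟩ := (h1.and hB).exists
    let ω' : SamplePoint J := (ω.1, Function.update ω.2 j fun _ => F.image fun p => p.1 ω)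
    have hag : ∀ i < j, ω'.2 i = ω.2 i := fun i hi => Function.update_of_ne hi.ne _ _
    refine ⟨ω', hBU ?_, ?_⟩
    · have : truncate j ω' = truncate j ω := by
        refine Prod.ext rfl (funext fun i => ?_)
        by_cases hi : i < j
        · simp [truncate, hi, hag i hi]
        · simp [truncate, hi]
      rw [Set.mem_preimage, this]
      exact hωB
    · simp only [Set.mem_iInter]
      intro p hp
      have hx : p.1 ω' = p.1 ω := (hF hp).1 _ _ rfl hag
      have hh : p.2.1 ω' = p.2.1 ω := (hF hp).2.1 _ _ rfl hag
      have hj : ω'.2 j (p.2.1 ω') = F.image fun p => p.1 ω := by simp [ω']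
      refine ⟨?_, ?_⟩
      · rw [hj, hx]
        exact Finset.mem_image_of_mem _ hp
      · rw [hj, hh]
        exact (Nat.mul_le_mul_left _ Finset.card_image_le).trans (hω p hp)

theorem captureFilter_le_comap (j : J) (D : Filter (SamplePoint J)) :
    captureFilter j D ≤ comap (truncate j) (map (truncate j) D) :=
  (iInf_le _ ⟨∅, by simp⟩).trans inf_le_left

theorem captureSet_mem (j : J) (D : Filter (SamplePoint J))
    {p : (SamplePoint J → ℕ) × (SamplePoint J → ℕ) × ℕ} (hp : p ∈ captureData j D) :
    captureSet j p ∈ captureFilter j D := by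
  refine mem_of_superset ((iInf_le _ ⟨{p}, by simpa using hp⟩ : captureFilter j D ≤ _)
    (mem_inf_of_right (mem_principal_self _))) ?_
  simp

/-- The filter at `i` concerns only the natural number and coordinates up to `i`, so truncating at a
later `j` loses none of its information. -/
theorem comap_map_captureFilter_le {i j : J} (hij : i < j) (D : Filter (SamplePoint J)) :
    comap (truncate j) (map (truncate j) (captureFilter i D)) ≤ captureFilter i D := by
  refine le_iInf fun F => ?_
  refine (comap_mono (map_mono (iInf_le _ F))).trans (le_inf ?_ ?_)
  · refine (comap_mono (map_mono inf_le_left)).trans ?_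
    rw [← truncate_comp_truncate hij.le, ← comap_comap]
    exact comap_mono map_comap_le
  · refine (comap_mono (map_mono inf_le_right)).trans ?_
    rw [map_principal, comap_principal, principal_mono]
    rintro ω ⟨ω', hω', h⟩
    have hag : ∀ l < j, ω'.2 l = ω.2 l := by
      intro l hl
      have := congrFun (congrArg Prod.snd h) l
      simpa [truncate, hl] using this
    have h1 : ω'.1 = ω.1 := by simpa [truncate] using congrArg Prod.fst h
    simp only [Set.mem_iInter] at hω' ⊢
    intro p hp
    have := hω' p hp
    have hx : p.1 ω' = p.1 ω := (F.2 hp).1 _ _ h1 fun l hl => hag l (hl.trans hij)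
    have hh : p.2.1 ω' = p.2.1 ω := (F.2 hp).2.1 _ _ h1 fun l hl => hag l (hl.trans hij)
    simpa only [captureSet, Set.mem_ofPred_eq, hx, hh, hag i hij] using this

/-- The requirements from all coordinates in `s`, given the ultrafilters `D i`. -/
noncomputable def limitFilter (s : Set J) (D : ∀ i ∈ s, Ultrafilter (SamplePoint J)) :
    Filter (SamplePoint J) :=
  comap Prod.fst atTop ⊓ ⨅ i, ⨅ h : i ∈ s, captureFilter i (D i h)

/-- Each `D j` refines the requirements of earlier indices, so the filters `captureFilter i (D i)`
decrease with `i`. Their infimum is then directed, hence proper. -/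
theorem limitFilter_neBot (D : J → Ultrafilter (SamplePoint J)) (s : Set J)
    (hs : ∀ i ∈ s, Set.Iio i ⊆ s)
    (hD : ∀ i ∈ s, ↑(D i) ≤ limitFilter (Set.Iio i) fun l _ => D l) :
    (limitFilter s fun l _ => D l).NeBot := by
  -- Truncation keeps the natural number, so every capture filter already makes it unlimited; the
  -- separate factor in `limitFilter` matters only for empty `s`.
  have hle : ∀ i ∈ s, captureFilter i (D i) ≤ comap Prod.fst atTop := by
    intro i hi
    have h1 : (D i : Filter (SamplePoint J)) ≤ comap Prod.fst atTop := (hD i hi).trans inf_le_left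
    refine (captureFilter_le_comap i _).trans ((comap_mono (map_mono h1)).trans ?_)
    have : (Prod.fst : SamplePoint J → ℕ) = Prod.fst ∘ truncate i := rfl
    rw [this, ← comap_comap]
    exact comap_mono map_comap_le
  have hanti : ∀ i ∈ s, ∀ j ∈ s, i ≤ j → captureFilter j (D j) ≤ captureFilter i (D i) := by
    intro i hi j hj hij
    rcases hij.eq_or_lt with rfl | hij
    · exact le_rfl
    have h1 : (D j : Filter (SamplePoint J)) ≤ captureFilter i (D i) :=
      (hD j hj).trans (inf_le_right.trans (iInf₂_le i hij))
    exact (captureFilter_le_comap j _).trans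
      ((comap_mono (map_mono h1)).trans (comap_map_captureFilter_le hij _))
  rcases s.eq_empty_or_nonempty with rfl | hne
  · have : (comap (Prod.fst : SamplePoint J → ℕ) atTop).NeBot :=
      (atTop_neBot).comap_of_surj Prod.fst_surjective
    simpa [limitFilter] using this
  · obtain ⟨i0, hi0⟩ := hne
    have : Nonempty s := ⟨⟨i0, hi0⟩⟩
    have heq : (limitFilter s fun l _ => D l) = ⨅ i : s, captureFilter i.1 (D i.1) := by
      rw [limitFilter, iInf_subtype']
      exact inf_eq_right.2 ((iInf_le _ ⟨i0, hi0⟩).trans (hle i0 hi0))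
    rw [heq]
    refine iInf_neBot_of_directed' ?_ fun i => captureFilter_neBot _ _
    intro i j
    rcases le_total i.1 j.1 with h | h
    · exact ⟨j, hanti _ i.2 _ j.2 h, le_rfl⟩
    · exact ⟨i, le_rfl, hanti _ j.2 _ i.2 h⟩

variable [WellFoundedLT J]

variable (J) in
theorem exists_coherent_ultrafilters :
    ∃ D : J → Ultrafilter (SamplePoint J),
      ∀ i, ↑(D i) ≤ limitFilter (Set.Iio i) fun l _ => D l := by
  -- The recursion must return an ultrafilter before properness is known; the induction below shows
  -- that `pure default` is never used.
  let D : J → Ultrafilter (SamplePoint J) :=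
    WellFounded.fix (C := fun _ => Ultrafilter (SamplePoint J)) (wellFounded_lt) fun i R =>
      if h : (limitFilter (Set.Iio i) R).NeBot then @Ultrafilter.of _ _ h else pure default
  have hfix : ∀ i, D i = if h : (limitFilter (Set.Iio i) fun l _ => D l).NeBot then
      @Ultrafilter.of _ _ h else pure default := fun i => WellFounded.fix_eq _ _ _
  refine ⟨D, fun i => ?_⟩
  induction i using WellFoundedLT.induction with
  | ind i ih =>
    have h := limitFilter_neBot D (Set.Iio i) (fun l hl m hm => lt_trans hm hl) ih
    have := hfix i
    rw [dif_pos h] at this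
    rw [this]
    exact Ultrafilter.of_le _

variable (J) in
/-- There is an ultrafilter for which the first component is unlimited and every `j`-th
coordinate, at an unlimited argument `h`, is a set small compared with `h` that contains the values
of all functions that depend on coordinates before `j`. -/
theorem exists_capturing_ultrafilter :
    ∃ D : Ultrafilter (SamplePoint J), Tendsto Prod.fst (D : Filter (SamplePoint J)) atTop ∧
      ∀ (j : J) (x h : SamplePoint J → ℕ) (n : ℕ), SupportedOn x (Set.Iio j) →
        SupportedOn h (Set.Iio j) → Tendsto h D atTop →
        ∀ᶠ ω in D, x ω ∈ ω.2 j (h ω) ∧ n * (ω.2 j (h ω)).card ≤ h ω := by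
  obtain ⟨D, hD⟩ := exists_coherent_ultrafilters J
  have hne := limitFilter_neBot D Set.univ (fun _ _ => Set.subset_univ _) (fun i _ => hD i)
  refine ⟨Ultrafilter.of (limitFilter Set.univ fun l _ => D l), ?_, ?_⟩
  · exact map_le_iff_le_comap.2 ((Ultrafilter.of_le _).trans inf_le_left)
  · intro j x h n hx hh hlim
    have hle : (Ultrafilter.of (limitFilter Set.univ fun l _ => D l) : Filter (SamplePoint J)) ≤
        captureFilter j (D j) :=
      (Ultrafilter.of_le _).trans (inf_le_right.trans (iInf₂_le j (Set.mem_univ j)))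
    -- The final ultrafilter and `D j` agree on sets depending only on coordinates below `j`, so `h`
    -- is unlimited for one as well as for the other.
    have hlim' : Tendsto h (D j) atTop := by
      rw [tendsto_atTop]
      intro k
      by_contra hk
      rw [← Ultrafilter.eventually_not] at hk
      have h1 : ∀ᶠ ω in captureFilter j (D j), ¬ k ≤ h ω := by
        refine captureFilter_le_comap j _ ?_
        refine ⟨{ω | ¬ k ≤ h ω}, ?_, ?_⟩
        · rw [mem_map]
          filter_upwards [hk] with ω hω
          rw [Set.mem_preimage, Set.mem_ofPred_eq, hh.truncate_eq]
          exact hω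
        · intro ω hω
          rw [Set.mem_preimage, Set.mem_ofPred_eq, hh.truncate_eq] at hω
          exact hω
      obtain ⟨ω, h2, h3⟩ := ((hlim.eventually_ge_atTop k).and (hle h1)).exists
      exact h3 h2
    exact hle (captureSet_mem j (D j) (p := (x, h, n)) ⟨hx, hh, hlim'⟩)

end Capture

/-! ### The limit ultrapower -/

/-- The function depends on countably many coordinates only. -/
def CountablySupported {J : Type u} {α : Type*} (f : SamplePoint J → α) : Prop :=
  ∃ s : Set J, s.Countable ∧ SupportedOn f s

namespace CountablySupported

variable {J : Type u} {α β γ : Type*}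

theorem const (a : α) : CountablySupported (J := J) fun _ => a :=
  ⟨∅, Set.countable_empty, fun _ _ _ _ => rfl⟩

theorem fst : CountablySupported (J := J) Prod.fst :=
  ⟨∅, Set.countable_empty, fun _ _ h _ => h⟩

theorem coord (j : J) : CountablySupported (J := J) fun ω => ω.2 j :=
  ⟨{j}, Set.countable_singleton j, fun _ _ _ h => h j rfl⟩

theorem comp {f : SamplePoint J → α} (hf : CountablySupported f) (g : α → β) :
    CountablySupported fun ω => g (f ω) := by
  obtain ⟨s, hs, h⟩ := hf
  exact ⟨s, hs, fun x y h1 h2 => congrArg g (h x y h1 h2)⟩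

theorem pi {ι : Type*} [Countable ι] {f : ι → SamplePoint J → α}
    (hf : ∀ i, CountablySupported (f i)) : CountablySupported fun ω i => f i ω := by
  choose s hs h using hf
  refine ⟨⋃ i, s i, Set.countable_iUnion hs, fun x y h1 h2 => funext fun i => ?_⟩
  exact h i x y h1 fun j hj => h2 j (Set.mem_iUnion.2 ⟨i, hj⟩)

theorem prodMk {f : SamplePoint J → α} {g : SamplePoint J → β} (hf : CountablySupported f)
    (hg : CountablySupported g) : CountablySupported fun ω => (f ω, g ω) := by
  obtain ⟨s, hs, h⟩ := hf
  obtain ⟨t, ht, h'⟩ := hg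
  exact ⟨s ∪ t, hs.union ht, fun x y h1 h2 => Prod.ext
    (h x y h1 fun j hj => h2 j (Or.inl hj)) (h' x y h1 fun j hj => h2 j (Or.inr hj))⟩

theorem comp₂ {f : SamplePoint J → α} {g : SamplePoint J → β} (hf : CountablySupported f)
    (hg : CountablySupported g) (k : α → β → γ) : CountablySupported fun ω => k (f ω) (g ω) :=
  (hf.prodMk hg).comp fun p => k p.1 p.2

theorem supportedOn_Iio [LinearOrder J] {f : SamplePoint J → α} (hf : CountablySupported f)
    (hJ : ∀ s : Set J, s.Countable → ∃ b, ∀ j ∈ s, j < b) :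
    ∃ b, ∀ j, b ≤ j → SupportedOn f (Set.Iio j) := by
  obtain ⟨s, hs, h⟩ := hf
  obtain ⟨b, hb⟩ := hJ s hs
  exact ⟨b, fun j hbj x y h1 h2 => h x y h1 fun i hi => h2 i ((hb i hi).trans_le hbj)⟩

/-- The number of functions with countable support. -/
theorem mk_le (J : Type u) [Nonempty J] (α : Type) [Nonempty α] :
    #{f : SamplePoint J → α // CountablySupported f} ≤
      #J ^ ℵ₀ * Cardinal.lift.{u} (#α ^ (𝔠 : Cardinal.{0})) := by
  have hI : #(ℕ × (ℕ → ℕ → Finset ℕ)) = 𝔠 := by simp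
  have hrhs : #((ℕ → J) × (ℕ × (ℕ → ℕ → Finset ℕ) → α)) =
      #J ^ ℵ₀ * Cardinal.lift.{u} (#α ^ (𝔠 : Cardinal.{0})) := by
    rw [Cardinal.mk_prod, ← hI, Cardinal.power_def]
    simp
  rw [← hrhs]
  let a : α := Classical.arbitrary α
  let π : (ℕ → J) → SamplePoint J → ℕ × (ℕ → ℕ → Finset ℕ) := fun e ω => (ω.1, fun n => ω.2 (e n))
  have hex : ∀ f : {f : SamplePoint J → α // CountablySupported f},
      ∃ p : (ℕ → J) × (ℕ × (ℕ → ℕ → Finset ℕ) → α), f.1 = p.2 ∘ π p.1 := by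
    rintro ⟨f, s, hs, h⟩
    -- The extra index makes the support nonempty, so that a sequence `e` can enumerate it. Then `f`
    -- factors through the projection to a set of size `𝔠`.
    obtain ⟨e, he⟩ := (hs.insert (Classical.arbitrary J)).exists_eq_range (Set.insert_nonempty _ _)
    have hfac : Function.FactorsThrough f (π e) := by
      intro x y (hxy : π e x = π e y)
      have h1 := congrArg Prod.fst hxy
      refine h x y h1 fun j hj => ?_
      obtain ⟨n, rfl⟩ : j ∈ Set.range e := he ▸ Set.mem_insert_of_mem _ hj
      exact congrFun (congrArg Prod.snd hxy) n
    refine ⟨(e, Function.extend (π e) f fun _ => a), ?_⟩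
    funext ω
    exact (hfac.extend_apply (fun _ => a) ω).symm
  choose p hp using hex
  refine Cardinal.mk_le_of_injective (f := p) fun f g hfg => Subtype.ext ?_
  rw [hp f, hp g, hfg]

end CountablySupported

section LimitUltrapower

open Filter FirstOrder.Language

variable {J : Type u} (D : Ultrafilter (SamplePoint J))

/-- The class of a function in the ultrapower. -/
def toProduct (f : SamplePoint J → StdUniverse) :
    (D : Filter (SamplePoint J)).Product fun _ => StdUniverse :=
  Quotient.mk _ f

theorem toProduct_eq_iff {f g : SamplePoint J → StdUniverse} :
    toProduct D f = toProduct D g ↔ ∀ᶠ ω in D, f ω = g ω :=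
  Quotient.eq

instance : Nonempty StdUniverse := ⟨StdUniverse.atom 0⟩

/-- The classes of the functions with countable support. -/
def limitSubstructure :
    memLanguage.Substructure ((D : Filter (SamplePoint J)).Product fun _ => StdUniverse) where
  carrier := {m | ∃ f, CountablySupported f ∧ m = toProduct D f}
  fun_mem := fun f => f.elim

/-- The elementary substructure of the ultrapower given by the functions with countable support. -/
noncomputable def limitUltrapower :
    memLanguage.ElementarySubstructure
      ((D : Filter (SamplePoint J)).Product fun _ => StdUniverse) :=
  (limitSubstructure D).toElementarySubstructure (by
    intro n φ x a ha
    choose f hf hxf using fun i => (x i).2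
    obtain ⟨g, rfl⟩ := Quotient.exists_rep a
    have hsnoc : ∀ g : SamplePoint J → StdUniverse,
        (Fin.snoc (Subtype.val ∘ x) (toProduct D g) : Fin (n + 1) → _) =
          fun i => toProduct D ((Fin.snoc f g : Fin (n + 1) → SamplePoint J → StdUniverse) i) := by
      intro g
      funext i
      refine Fin.lastCases ?_ (fun i => ?_) i
      · simp
      · simp [hxf]
    have hlos : ∀ g : SamplePoint J → StdUniverse,
        φ.Realize default (Fin.snoc (Subtype.val ∘ x) (toProduct D g) : Fin (n + 1) → _) ↔
          ∀ᶠ ω in D, φ.Realize default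
            (Fin.snoc (fun i => f i ω) (g ω) : Fin (n + 1) → StdUniverse) := by
      intro g
      rw [hsnoc, Subsingleton.elim (default : Empty → _) (fun i => toProduct D (i.elim))]
      refine (Ultraproduct.boundedFormula_realize_cast φ
        (fun i : Empty => i.elim) (Fin.snoc f g)).trans ?_
      refine eventually_congr (Eventually.of_forall fun ω => ?_)
      have h1 : (fun i => (Fin.snoc f g : Fin (n + 1) → SamplePoint J → StdUniverse) i ω) =
          (Fin.snoc (fun i => f i ω) (g ω) : Fin (n + 1) → StdUniverse) := by
        funext i
        refine Fin.lastCases ?_ (fun i => ?_) i <;> simp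
      rw [h1, Subsingleton.elim (default : Empty → StdUniverse)]
    have ha' := (hlos g).1 ha
    -- Tarski–Vaught with a Skolem function: a witness chosen from the values of finitely many
    -- parameters again has countable support.
    let w : (Fin n → StdUniverse) → StdUniverse := fun y =>
      Classical.epsilon fun v => φ.Realize default (Fin.snoc y v : Fin (n + 1) → StdUniverse)
    refine ⟨⟨toProduct D fun ω => w fun i => f i ω, _, (CountablySupported.pi hf).comp w, rfl⟩,
      (hlos _).2 ?_⟩
    filter_upwards [ha'] with ω hω
    exact Classical.epsilon_spec (p := fun v => φ.Realize default
      (Fin.snoc (fun i => f i ω) v : Fin (n + 1) → StdUniverse)) ⟨_, hω⟩)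

/-- The class of a function with countable support. -/
def toLimit (f : SamplePoint J → StdUniverse) (hf : CountablySupported f) : limitUltrapower D :=
  ⟨toProduct D f, f, hf, rfl⟩

theorem toLimit_eq_iff {f g : SamplePoint J → StdUniverse} {hf : CountablySupported f}
    {hg : CountablySupported g} : toLimit D f hf = toLimit D g hg ↔ ∀ᶠ ω in D, f ω = g ω := by
  rw [← toProduct_eq_iff]
  exact Subtype.ext_iff

theorem structMem_toLimit {f g : SamplePoint J → StdUniverse} {hf : CountablySupported f}
    {hg : CountablySupported g} :
    StructMem (toLimit D f hf) (toLimit D g hg) ↔ ∀ᶠ ω in D, StdUniverse.Mem (f ω) (g ω) := by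
  refine ((limitUltrapower D).subtype.map_rel MemSymbol.mem
    ![toLimit D f hf, toLimit D g hg]).symm.trans ?_
  have h1 : (limitUltrapower D).subtype ∘ ![toLimit D f hf, toLimit D g hg] =
      fun i => toProduct D ((![f, g] : Fin 2 → SamplePoint J → StdUniverse) i) := by
    funext i
    fin_cases i <;> rfl
  rw [h1]
  exact relMap_quotient_mk' (L := memLanguage)
    (s := (D : Filter (SamplePoint J)).productSetoid fun _ => StdUniverse)
    (show memLanguage.Relations 2 from MemSymbol.mem) ![f, g]

/-- The nonstandard universe defined by an ultrafilter with unlimited first component. -/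
noncomputable def limitUniverse (hD : Tendsto Prod.fst (D : Filter (SamplePoint J)) atTop) :
    NonstdUniverse.{u} where
  Big := limitUltrapower D
  emb :=
    { toFun := fun v => toLimit D (fun _ => v) (CountablySupported.const v)
      map_formula' := by
        intro n φ x
        rw [← (limitUltrapower D).subtype.map_formula]
        refine (Ultraproduct.realize_formula_cast φ (fun i _ => x i)).trans ?_
        simp }
  exists_nonstandard := by
    refine ⟨toLimit D (fun ω => StdUniverse.atom ω.1) (CountablySupported.fst.comp _), ?_, ?_⟩
    · refine (structMem_toLimit D (hg := CountablySupported.const _)).2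
        (Eventually.of_forall fun ω => ?_)
      exact StdUniverse.mem_levelSet_zero.2 ⟨_, rfl⟩
    · intro k h
      have h1 := (toLimit_eq_iff D (hg := CountablySupported.const _)).1 h
      obtain ⟨ω, h2, h3⟩ := (h1.and (hD.eventually_gt_atTop k)).exists
      exact h3.ne' (StdUniverse.atom_injective h2)

end LimitUltrapower

/-! ### Transfer for the limit universe -/

section Transfer

open Filter hiding mk
open StdUniverse

variable {J : Type u} {D : Ultrafilter (SamplePoint J)}

/-- The functions that represent elements of the nonstandard universe. -/
def IsInternal (D : Ultrafilter (SamplePoint J)) (f : SamplePoint J → StdUniverse) : Prop :=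
  CountablySupported f ∧ ∃ n, ∀ᶠ ω in D, f ω ∈ Set.range (mk n)

theorem IsInternal.const (v : StdUniverse) : IsInternal D fun _ => v :=
  ⟨CountablySupported.const v, (exists_mem_range_mk v).imp fun _ h => Eventually.of_forall fun _ => h⟩

theorem IsInternal.of_mem {f g : SamplePoint J → StdUniverse} (hf : CountablySupported f)
    (hg : IsInternal D g) (h : ∀ᶠ ω in D, Mem (f ω) (g ω)) : IsInternal D f := by
  obtain ⟨-, n, hn⟩ := hg
  refine ⟨hf, n, ?_⟩
  filter_upwards [h, hn] with ω h1 h2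
  exact mem_range_mk_of_mem h1 h2

theorem isInternal_atom {x : SamplePoint J → ℕ} (hx : CountablySupported x) :
    IsInternal D fun ω => atom (x ω) :=
  ⟨hx.comp _, 0, Eventually.of_forall fun ω => ⟨x ω, rfl⟩⟩

theorem isInternal_finSet {a : SamplePoint J → Finset ℕ} (ha : CountablySupported a) :
    IsInternal D fun ω => finSet (a ω) :=
  ⟨ha.comp _, 1, Eventually.of_forall fun _ => ⟨_, rfl⟩⟩

variable (hD : Tendsto Prod.fst (D : Filter (SamplePoint J)) atTop)

/-- The element of the nonstandard universe represented by a function. -/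
noncomputable def germ (f : SamplePoint J → StdUniverse) (hf : IsInternal D f) :
    (limitUniverse D hD).Carrier :=
  ⟨toLimit D f hf.1, by
    obtain ⟨-, n, hn⟩ := hf
    refine ⟨n, (structMem_toLimit D (hg := CountablySupported.const _)).2 ?_⟩
    filter_upwards [hn] with ω h
    exact mem_levelSet.2 h⟩

/-- The nonstandard natural number represented by a function. -/
noncomputable def natGerm (x : SamplePoint J → ℕ) (hx : CountablySupported x) :
    (limitUniverse D hD).Carrier :=
  germ hD (fun ω => atom (x ω)) (isInternal_atom hx)

/-- The hyperfinite set of nonstandard natural numbers represented by a function. -/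
noncomputable def finGerm (a : SamplePoint J → Finset ℕ) (ha : CountablySupported a) :
    (limitUniverse D hD).Carrier :=
  germ hD (fun ω => finSet (a ω)) (isInternal_finSet ha)

variable {hD}

theorem exists_eq_germ (x : (limitUniverse D hD).Carrier) : ∃ f hf, x = germ hD f hf := by
  obtain ⟨⟨_, f, hf, rfl⟩, n, hn⟩ := x
  refine ⟨f, ⟨hf, n, ?_⟩, rfl⟩
  have h1 := (structMem_toLimit D (hf := hf) (hg := CountablySupported.const _)).1 hn
  filter_upwards [h1] with ω h
  exact mem_levelSet.1 h

theorem star_eq_germ (v : StdUniverse) :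
    (limitUniverse D hD).star v = germ hD (fun _ => v) (IsInternal.const v) := rfl

variable {f g x y z : SamplePoint J → StdUniverse} {hf : IsInternal D f} {hg : IsInternal D g}
  {hx : IsInternal D x} {hy : IsInternal D y} {hz : IsInternal D z}

theorem germ_eq_iff : germ hD f hf = germ hD g hg ↔ ∀ᶠ ω in D, f ω = g ω :=
  Subtype.ext_iff.trans (toLimit_eq_iff D (hf := hf.1) (hg := hg.1))

theorem mem_germ_iff :
    (limitUniverse D hD).Mem (germ hD f hf) (germ hD g hg) ↔ ∀ᶠ ω in D, Mem (f ω) (g ω) :=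
  structMem_toLimit D (hf := hf.1) (hg := hg.1)

/-- Transfer of universal quantifiers. -/
theorem eventually_forall_of_internal {β : Type*} {p : SamplePoint J → β}
    (hp : CountablySupported p) (R : β → StdUniverse → Prop) (n : ℕ)
    (hn : ∀ᶠ ω in D, ∀ v, ¬ R (p ω) v → v ∈ Set.range (mk n))
    (h : ∀ f, IsInternal D f → ∀ᶠ ω in D, R (p ω) (f ω)) : ∀ᶠ ω in D, ∀ v, R (p ω) v := by
  by_contra hcon
  rw [← Ultrafilter.eventually_not] at hcon
  -- A counterexample chosen as a function of `p ω` has countable support, and `hn` bounds its rank.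
  -- Both are needed for it to represent an element of the truncated universe.
  let w : β → StdUniverse := fun b => Classical.epsilon fun v => ¬ R b v
  have hw : ∀ᶠ ω in D, ¬ R (p ω) (w (p ω)) := by
    filter_upwards [hcon] with ω hω
    exact Classical.epsilon_spec (p := fun v => ¬ R (p ω) v) (not_forall.1 hω)
  have hwi : IsInternal D fun ω => w (p ω) := by
    refine ⟨hp.comp w, n, ?_⟩
    filter_upwards [hw, hn] with ω h1 h2
    exact h2 _ h1
  obtain ⟨ω, h1, h2⟩ := (hw.and (h _ hwi)).exists
  exact h1 h2

theorem isUPair_germ_iff :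
    IsUPair (limitUniverse D hD).Mem (germ hD z hz) (germ hD x hx) (germ hD y hy) ↔
      ∀ᶠ ω in D, IsUPair Mem (z ω) (x ω) (y ω) := by
  constructor
  · intro h
    obtain ⟨l, hl⟩ := hx.2
    obtain ⟨m, hm⟩ := hy.2
    obtain ⟨n, hn⟩ := hz.2
    refine eventually_forall_of_internal (hz.1.prodMk (hx.1.prodMk hy.1))
      (fun b v => Mem v b.1 ↔ v = b.2.1 ∨ v = b.2.2) (max l (max m n)) ?_ ?_
    · filter_upwards [hl, hm, hn] with ω h1 h2 h3 v hv
      by_cases hvz : Mem v (z ω)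
      · exact range_mk_mono (by omega) (mem_range_mk_of_mem hvz h3)
      · have : v = x ω ∨ v = y ω := by
          by_contra h4
          exact hv ⟨fun h => absurd h hvz, fun h => absurd h h4⟩
        rcases this with rfl | rfl
        · exact range_mk_mono (by omega) h1
        · exact range_mk_mono (by omega) h2
    · intro f hf
      have h1 := h (germ hD f hf)
      rw [mem_germ_iff, germ_eq_iff, germ_eq_iff, ← Ultrafilter.eventually_or] at h1
      by_cases h2 : ∀ᶠ ω in D, Mem (f ω) (z ω)
      · filter_upwards [h2, h1.1 h2] with ω h3 h4
        exact iff_of_true h3 h4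
      · have h3 := mt h1.2 h2
        rw [← Ultrafilter.eventually_not] at h2 h3
        filter_upwards [h2, h3] with ω h4 h5
        exact iff_of_false h4 h5
  · intro h w
    obtain ⟨f, hf, rfl⟩ := exists_eq_germ w
    rw [mem_germ_iff, germ_eq_iff, germ_eq_iff, ← Ultrafilter.eventually_or]
    refine eventually_congr ?_
    filter_upwards [h] with ω hω
    exact hω _

theorem isOPair_germ_iff :
    IsOPair (limitUniverse D hD).Mem (germ hD z hz) (germ hD x hx) (germ hD y hy) ↔
      ∀ᶠ ω in D, IsOPair Mem (z ω) (x ω) (y ω) := by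
  constructor
  · intro h
    obtain ⟨l, hl⟩ := hx.2
    obtain ⟨m, hm⟩ := hy.2
    obtain ⟨n, hn⟩ := hz.2
    refine eventually_forall_of_internal (hz.1.prodMk (hx.1.prodMk hy.1))
      (fun b v => Mem v b.1 ↔ IsUPair Mem v b.2.1 b.2.1 ∨ IsUPair Mem v b.2.1 b.2.2)
      (max l (max m n) + 1) ?_ ?_
    · filter_upwards [hl, hm, hn] with ω h1 h2 h3 v hv
      have h1' := range_mk_mono (show l ≤ max l (max m n) by omega) h1
      have h2' := range_mk_mono (show m ≤ max l (max m n) by omega) h2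
      by_cases hvz : Mem v (z ω)
      · exact range_mk_mono (by omega) (mem_range_mk_of_mem hvz h3)
      · have : IsUPair Mem v (x ω) (x ω) ∨ IsUPair Mem v (x ω) (y ω) := by
          by_contra h4
          exact hv ⟨fun h => absurd h hvz, fun h => absurd h h4⟩
        rcases this with h | h
        · exact IsUPair.mem_range_mk h h1' h1'
        · exact IsUPair.mem_range_mk h h1' h2'
    · intro f hf
      have h1 := h (germ hD f hf)
      rw [mem_germ_iff, isUPair_germ_iff, isUPair_germ_iff, ← Ultrafilter.eventually_or] at h1
      by_cases h2 : ∀ᶠ ω in D, Mem (f ω) (z ω)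
      · filter_upwards [h2, h1.1 h2] with ω h3 h4
        exact iff_of_true h3 h4
      · have h3 := mt h1.2 h2
        rw [← Ultrafilter.eventually_not] at h2 h3
        filter_upwards [h2, h3] with ω h4 h5
        exact iff_of_false h4 h5
  · intro h w
    obtain ⟨f, hf, rfl⟩ := exists_eq_germ w
    rw [mem_germ_iff, isUPair_germ_iff, isUPair_germ_iff, ← Ultrafilter.eventually_or]
    refine eventually_congr ?_
    filter_upwards [h] with ω hω
    exact hω _

/-- In the converse direction the pair is chosen from its two components, so it has countable
support; as a member of `r` it has bounded rank. -/
theorem starRel_germ_iff {r : StdUniverse} :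
    (limitUniverse D hD).StarRel r (germ hD x hx) (germ hD y hy) ↔
      ∀ᶠ ω in D, ∃ p, IsOPair Mem p (x ω) (y ω) ∧ Mem p r := by
  constructor
  · rintro ⟨p, hp, hpr⟩
    obtain ⟨f, hf, rfl⟩ := exists_eq_germ p
    rw [star_eq_germ, mem_germ_iff] at hpr
    filter_upwards [isOPair_germ_iff.1 hp, hpr] with ω h1 h2
    exact ⟨_, h1, h2⟩
  · intro h
    let w : StdUniverse × StdUniverse → StdUniverse := fun b =>
      Classical.epsilon fun p => IsOPair Mem p b.1 b.2 ∧ Mem p r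
    have hw : ∀ᶠ ω in D, IsOPair Mem (w (x ω, y ω)) (x ω) (y ω) ∧ Mem (w (x ω, y ω)) r := by
      filter_upwards [h] with ω hω
      exact Classical.epsilon_spec hω
    have hwi : IsInternal D fun ω => w (x ω, y ω) :=
      IsInternal.of_mem ((hx.1.prodMk hy.1).comp w) (IsInternal.const r) (hw.mono fun _ h => h.2)
    exact ⟨germ hD _ hwi, isOPair_germ_iff.2 (hw.mono fun _ h => h.1),
      (mem_germ_iff (hg := IsInternal.const r)).2 (hw.mono fun _ h => h.2)⟩

theorem starRel_natRel_iff {R : ℕ → ℕ → Prop} :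
    (limitUniverse D hD).StarRel (natRel R) (germ hD x hx) (germ hD y hy) ↔
      ∀ᶠ ω in D, ∃ k l, R k l ∧ x ω = atom k ∧ y ω = atom l := by
  rw [starRel_germ_iff]
  refine eventually_congr (Eventually.of_forall fun ω => ⟨?_, fun h => ?_⟩)
  · rintro ⟨p, h1, h2⟩
    exact (mem_natRel_of_isOPair h1).1 h2
  · obtain ⟨p, hp⟩ := exists_isOPair (x ω) (y ω)
    exact ⟨p, hp, (mem_natRel_of_isOPair hp).2 h⟩

theorem starRel_cardFun_iff :
    (limitUniverse D hD).StarRel cardFun (germ hD x hx) (germ hD y hy) ↔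
      ∀ᶠ ω in D, ∃ A : Finset ℕ, x ω = finSet A ∧ y ω = atom A.card := by
  rw [starRel_germ_iff]
  refine eventually_congr (Eventually.of_forall fun ω => ⟨?_, fun h => ?_⟩)
  · rintro ⟨p, h1, h2⟩
    exact (mem_cardFun_of_isOPair h1).1 h2
  · obtain ⟨p, hp⟩ := exists_isOPair (x ω) (y ω)
    exact ⟨p, hp, (mem_cardFun_of_isOPair hp).2 h⟩

theorem exists_eq_natGerm {x : (limitUniverse D hD).Carrier} {f : SamplePoint J → StdUniverse}
    {hf : IsInternal D f} (hx : x = germ hD f hf) (h : ∀ᶠ ω in D, ∃ k, f ω = atom k) :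
    ∃ y hy, x = natGerm hD y hy := by
  let w : StdUniverse → ℕ := fun v => Classical.epsilon fun k => v = atom k
  refine ⟨fun ω => w (f ω), hf.1.comp w, ?_⟩
  rw [hx, natGerm, germ_eq_iff]
  filter_upwards [h] with ω hω
  exact Classical.epsilon_spec hω

theorem limitUniverse_isOmegaOneSaturated : (limitUniverse D hD).IsOmegaOneSaturated := by
  intro A hA
  choose a ha hAa using fun i => exists_eq_germ (A i)
  let Good : (ℕ → StdUniverse) → ℕ → Prop := fun b n => ∃ v, ∀ i < n, Mem v (b i)
  have hgood : ∀ n, ∀ᶠ ω in D, Good (fun i => a i ω) n := by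
    intro n
    obtain ⟨x, hx⟩ := hA (Finset.range n)
    obtain ⟨f, hf, rfl⟩ := exists_eq_germ x
    have h1 : ∀ i ∈ Finset.range n, ∀ᶠ ω in D, Mem (f ω) (a i ω) := by
      intro i hi
      have h2 := hx i hi
      rw [hAa i] at h2
      exact mem_germ_iff.1 h2
    filter_upwards [(eventually_all_finset _).2 h1] with ω hω
    exact ⟨f ω, fun i hi => hω i (Finset.mem_range.2 hi)⟩
  classical
  let N : ℕ × (ℕ → StdUniverse) → ℕ := fun b => Nat.findGreatest (Good b.2) b.1
  let w : ℕ × (ℕ → StdUniverse) → StdUniverse := fun b =>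
    Classical.epsilon fun v => ∀ i < N b, Mem v (b.2 i)
  have hw : ∀ b, ∀ i < N b, Mem (w b) (b.2 i) := by
    intro b
    have h1 : Good b.2 (N b) :=
      Nat.findGreatest_spec (P := Good b.2) (m := 0) (Nat.zero_le _)
        ⟨atom 0, fun i hi => absurd hi (Nat.not_lt_zero i)⟩
    exact Classical.epsilon_spec h1
  have hcs : CountablySupported fun ω : SamplePoint J => w (ω.1, fun i => a i ω) :=
    (CountablySupported.fst.prodMk (CountablySupported.pi fun i => (ha i).1)).comp w
  have hmem : ∀ i, ∀ᶠ ω in D, Mem (w (ω.1, fun i => a i ω)) (a i ω) := by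
    intro i
    filter_upwards [hgood (i + 1), hD.eventually_ge_atTop (i + 1)] with ω h1 h2
    exact hw (ω.1, fun i => a i ω) i (Nat.le_findGreatest h2 h1)
  refine ⟨germ hD _ (IsInternal.of_mem hcs (ha 0) (hmem 0)), fun i => ?_⟩
  rw [hAa i, mem_germ_iff]
  exact hmem i

/-! ### Hyperfinite integers and internal subsets of `Ω`. -/

section Hyperfinite

variable {h y k : SamplePoint J → ℕ} {a : SamplePoint J → Finset ℕ}
  {hh : CountablySupported h} {hy : CountablySupported y} {hk : CountablySupported k}
  {ha : CountablySupported a}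

theorem natGerm_eq_iff : natGerm hD y hy = natGerm hD k hk ↔ ∀ᶠ ω in D, y ω = k ω :=
  germ_eq_iff.trans (eventually_congr (Eventually.of_forall fun _ => atom_injective.eq_iff))

theorem IsHyperfinite.exists_eq_natGerm {H : (limitUniverse D hD).Carrier}
    (hH : (limitUniverse D hD).IsHyperfinite H) :
    ∃ h hh, H = natGerm hD h hh ∧ Tendsto h D atTop := by
  obtain ⟨h1, h2⟩ := hH
  obtain ⟨f, hf, rfl⟩ := exists_eq_germ H
  rw [star_eq_germ, mem_germ_iff] at h1
  obtain ⟨h, hh, heq⟩ := _root_.exists_eq_natGerm rfl (h1.mono fun _ => mem_levelSet_zero.1)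
  refine ⟨h, hh, heq, tendsto_atTop.2 fun n => ?_⟩
  have h3 : ∀ k ∈ Finset.range n, ∀ᶠ ω in D, h ω ≠ k := by
    intro k _
    have := h2 k
    rw [heq, star_eq_germ] at this
    have h4 := mt germ_eq_iff.2 this
    rw [← Ultrafilter.eventually_not] at h4
    exact h4.mono fun ω h5 h6 => h5 (congrArg atom h6)
  filter_upwards [(eventually_all_finset _).2 h3] with ω hω
  by_contra! hlt
  exact hω _ (Finset.mem_range.2 hlt) rfl

theorem natGerm_mem_Omega_iff :
    natGerm hD y hy ∈ (limitUniverse D hD).Omega (natGerm hD h hh) ↔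
      ∀ᶠ ω in D, y ω ∈ Finset.Icc 1 (h ω) := by
  refine starRel_natRel_iff.trans (eventually_congr (Eventually.of_forall fun ω => ?_))
  rw [Finset.mem_Icc]
  constructor
  · rintro ⟨k, l, h1, h2, h3⟩
    rwa [atom_injective h2, atom_injective h3]
  · intro h1
    exact ⟨_, _, h1, rfl, rfl⟩

theorem exists_eq_natGerm_of_mem_Omega {x : (limitUniverse D hD).Carrier}
    (hx : x ∈ (limitUniverse D hD).Omega (natGerm hD h hh)) :
    ∃ y hy, x = natGerm hD y hy ∧ ∀ᶠ ω in D, y ω ∈ Finset.Icc 1 (h ω) := by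
  obtain ⟨f, hf, rfl⟩ := exists_eq_germ x
  have h1 := starRel_natRel_iff.1 hx
  obtain ⟨y, hy, heq⟩ := exists_eq_natGerm rfl (h1.mono fun ω ⟨k, l, _, h2, _⟩ => ⟨k, h2⟩)
  refine ⟨y, hy, heq, natGerm_mem_Omega_iff (hy := hy).1 (heq ▸ hx)⟩

theorem natGerm_mem_finGerm_iff :
    (limitUniverse D hD).Mem (natGerm hD y hy) (finGerm hD a ha) ↔ ∀ᶠ ω in D, y ω ∈ a ω := by
  refine mem_germ_iff.trans (eventually_congr (Eventually.of_forall fun ω => ?_))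
  rw [finSet_eq, atom_mem_natSet, Finset.mem_coe]

theorem finGerm_mem_internalSubsets (hsub : ∀ᶠ ω in D, a ω ⊆ Finset.Icc 1 (h ω)) :
    finGerm hD a ha ∈ (limitUniverse D hD).InternalSubsets (natGerm hD h hh) := by
  constructor
  · rw [star_eq_germ]
    exact mem_germ_iff.2 (Eventually.of_forall fun ω => mem_powNat.2 ⟨_, finSet_eq _⟩)
  · intro x hx
    obtain ⟨f, hf, rfl⟩ := exists_eq_germ x
    have h1 := mem_germ_iff.1 hx
    refine starRel_natRel_iff.2 ?_
    filter_upwards [h1, hsub] with ω h2 h3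
    rw [finSet_eq] at h2
    obtain ⟨k, hk, hfk⟩ := mem_natSet.1 h2
    exact ⟨k, h ω, Finset.mem_Icc.1 (h3 hk), hfk, rfl⟩

theorem exists_eq_finGerm {A : (limitUniverse D hD).Carrier}
    (hA : A ∈ (limitUniverse D hD).InternalSubsets (natGerm hD h hh)) :
    ∃ a ha, A = finGerm hD a ha ∧ ∀ᶠ ω in D, a ω ⊆ Finset.Icc 1 (h ω) := by
  classical
  obtain ⟨h1, h2⟩ := hA
  obtain ⟨f, hf, rfl⟩ := exists_eq_germ A
  rw [star_eq_germ, mem_germ_iff] at h1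
  obtain ⟨n, hn⟩ := hf.2
  -- By transfer, almost every `f ω` is a set of naturals bounded by `h ω`, hence coded by a
  -- `Finset`.
  have h3 : ∀ᶠ ω in D, ∀ v, Mem v (f ω) → ∃ k ∈ Finset.Icc 1 (h ω), v = atom k := by
    refine eventually_forall_of_internal (hf.1.prodMk hh)
      (fun b v => Mem v b.1 → ∃ k ∈ Finset.Icc 1 b.2, v = atom k) n ?_ ?_
    · filter_upwards [hn] with ω h4 v hv
      exact mem_range_mk_of_mem (Classical.not_imp.1 hv).1 h4
    · intro g hg
      by_cases h4 : ∀ᶠ ω in D, Mem (g ω) (f ω)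
      · have h5 := starRel_natRel_iff.1 (h2 (germ hD g hg) (mem_germ_iff.2 h4))
        filter_upwards [h5] with ω h6 _
        obtain ⟨k, l, h7, h8, h9⟩ := h6
        obtain rfl := atom_injective h9
        exact ⟨k, Finset.mem_Icc.2 h7, h8⟩
      · rw [← Ultrafilter.eventually_not] at h4
        filter_upwards [h4] with ω h5 h6
        exact absurd h6 h5
  let w : StdUniverse → ℕ → Finset ℕ := fun v m => (Finset.Icc 1 m).filter fun k => Mem (atom k) v
  refine ⟨fun ω => w (f ω) (h ω), hf.1.comp₂ hh w, ?_,
    Eventually.of_forall fun ω => Finset.filter_subset _ _⟩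
  refine germ_eq_iff.2 ?_
  filter_upwards [h1, h3] with ω h4 h5
  obtain ⟨S, hS⟩ := mem_powNat.1 h4
  rw [hS, finSet_eq]
  congr 1
  ext k
  simp only [w, Finset.coe_filter, Set.mem_ofPred_eq, atom_mem_natSet]
  refine ⟨fun hk => ⟨?_, hk⟩, fun hk => hk.2⟩
  obtain ⟨l, hl, hkl⟩ := h5 (atom k) (by rw [hS, atom_mem_natSet]; exact hk)
  rwa [atom_injective hkl]

theorem stP_finGerm :
    (limitUniverse D hD).stP (natGerm hD h hh) (finGerm hD a ha) =
      sSup {r : ℝ | ∃ p q : ℕ, 0 < q ∧ r = (p : ℝ) / q ∧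
        ∀ᶠ ω in D, p * h ω ≤ q * (a ω).card} := by
  rw [NonstdUniverse.stP]
  congr 1
  ext r
  refine exists_congr fun p => exists_congr fun q => and_congr_right fun _ =>
    and_congr_right fun _ => ⟨?_, fun hle => ?_⟩
  · rintro ⟨K, hK1, hK2⟩
    obtain ⟨f, hf, rfl⟩ := exists_eq_germ K
    filter_upwards [starRel_cardFun_iff.1 hK1, starRel_natRel_iff.1 hK2] with ω h1 h2
    obtain ⟨A, hA, hfA⟩ := h1
    obtain ⟨k, l, hkl, hfk, hl⟩ := h2
    rw [finSet_injective hA, atom_injective hl, atom_injective (hfA.symm.trans hfk)]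
    exact hkl
  · refine ⟨natGerm hD (fun ω => (a ω).card) (ha.comp _), starRel_cardFun_iff.2 ?_,
      starRel_natRel_iff.2 ?_⟩
    · exact Eventually.of_forall fun ω => ⟨a ω, rfl, rfl⟩
    · filter_upwards [hle] with ω hω
      exact ⟨_, _, hω, rfl, rfl⟩

end Hyperfinite

end Transfer

/-! ### The Loeb spaces of the limit universe -/

section Loeb

open Filter hiding mk
open StdUniverse

variable {J : Type u} {D : Ultrafilter (SamplePoint J)}
  {hD : Tendsto Prod.fst (D : Filter (SamplePoint J)) atTop}
  {h : SamplePoint J → ℕ} {a : SamplePoint J → Finset ℕ}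
  {hh : CountablySupported h} {ha : CountablySupported a}

theorem stP_finGerm_nonneg :
    0 ≤ (limitUniverse D hD).stP (natGerm hD h hh) (finGerm hD a ha) := by
  rw [stP_finGerm]
  refine Real.sSup_nonneg ?_
  rintro _ ⟨p, q, -, rfl, -⟩
  positivity

theorem stP_finGerm_eq_zero (hlim : Tendsto h D atTop)
    (hsmall : ∀ n : ℕ, ∀ᶠ ω in D, n * (a ω).card ≤ h ω) :
    (limitUniverse D hD).stP (natGerm hD h hh) (finGerm hD a ha) = 0 := by
  refine le_antisymm ?_ stP_finGerm_nonneg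
  rw [stP_finGerm]
  refine Real.sSup_nonpos ?_
  rintro _ ⟨p, q, -, rfl, hpq⟩
  -- With `p ≥ 1`, the bounds `h ≤ q * |a|` and `(q + 1) * |a| ≤ h` force `|a| = 0`, and then `h =
  -- 0`; the multiplier `q` would not suffice.
  obtain ⟨ω, h1, h2, h3⟩ := (hpq.and ((hsmall (q + 1)).and (hlim.eventually_ge_atTop 1))).exists
  rcases Nat.eq_zero_or_pos p with rfl | hp
  · simp
  · have h4 := (Nat.le_mul_of_pos_left (h ω) hp).trans h1
    rw [Nat.add_mul, Nat.one_mul] at h2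
    have h5 : (a ω).card = 0 := by omega
    rw [h5] at h4
    omega

/-- Rounding up to denominator `q`: for `p = ⌊q * s⌋ + 1` the fraction `p / q` exceeds the supremum
`s`, so it is not below `|a| / h`. The set of admissible fractions is bounded by `1`, so `s` is a
genuine supremum. -/
theorem exists_card_lt (hlim : Tendsto h D atTop) (hsub : ∀ᶠ ω in D, a ω ⊆ Finset.Icc 1 (h ω))
    {q : ℕ} (hq : 0 < q) :
    ∃ p : ℕ, (p : ℝ) ≤ q * (limitUniverse D hD).stP (natGerm hD h hh) (finGerm hD a ha) + 1 ∧
      ∀ᶠ ω in D, q * (a ω).card < p * h ω := by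
  have h0 := stP_finGerm_nonneg (hD := hD) (hh := hh) (ha := ha)
  set s := (limitUniverse D hD).stP (natGerm hD h hh) (finGerm hD a ha) with hs
  have hq' : (0 : ℝ) < q := by exact_mod_cast hq
  refine ⟨⌊q * s⌋₊ + 1, ?_, ?_⟩
  · push_cast
    linarith [Nat.floor_le (mul_nonneg hq'.le h0)]
  · simp_rw [← not_le]
    rw [Ultrafilter.eventually_not]
    intro hle
    have hbdd : BddAbove {r : ℝ | ∃ p q : ℕ, 0 < q ∧ r = (p : ℝ) / q ∧
        ∀ᶠ ω in D, p * h ω ≤ q * (a ω).card} := by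
      refine ⟨1, ?_⟩
      rintro _ ⟨p, q, hq, rfl, hpq⟩
      obtain ⟨ω, h1, h2, h3⟩ := (hpq.and (hsub.and (hlim.eventually_ge_atTop 1))).exists
      have h4 := Finset.card_le_card h2
      rw [Nat.card_Icc, Nat.add_sub_cancel] at h4
      have h5 : p ≤ q := by
        have := h1.trans (Nat.mul_le_mul_left q h4)
        exact Nat.le_of_mul_le_mul_right this h3
      rw [div_le_one (by exact_mod_cast hq)]
      exact_mod_cast h5
    have h1 : ((⌊q * s⌋₊ + 1 : ℕ) : ℝ) / q ≤ s := by
      exact (le_csSup hbdd ⟨_, q, hq, rfl, hle⟩).trans stP_finGerm.ge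
    rw [div_le_iff₀ hq'] at h1
    have h2 := Nat.lt_floor_add_one (q * s)
    push_cast at h1
    linarith

/-- Counting at one sample point with all fractions rounded up to denominator `q` gives `q ≤ q * S +
N`. As `q` is arbitrary, `S ≥ 1`. -/
theorem one_le_sum_stP (hlim : Tendsto h D atTop) (a : ℕ → SamplePoint J → Finset ℕ)
    (ha : ∀ i, CountablySupported (a i))
    (hsub : ∀ i, ∀ᶠ ω in D, a i ω ⊆ Finset.Icc 1 (h ω)) (N : ℕ)
    (hcover : ∀ᶠ ω in D, Finset.Icc 1 (h ω) ⊆ (Finset.range N).biUnion fun i => a i ω) :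
    1 ≤ ∑ i ∈ Finset.range N,
      (limitUniverse D hD).stP (natGerm hD h hh) (finGerm hD (a i) (ha i)) := by
  set S := ∑ i ∈ Finset.range N,
      (limitUniverse D hD).stP (natGerm hD h hh) (finGerm hD (a i) (ha i)) with hS
  have key : ∀ q : ℕ, 0 < q → (q : ℝ) ≤ q * S + N := by
    intro q hq
    choose p hp1 hp2 using fun i =>
      exists_card_lt (hD := hD) (hh := hh) (ha := ha i) hlim (hsub i) hq
    obtain ⟨ω, h1, h2, h3⟩ := (hcover.and (((eventually_all_finset (Finset.range N)).2
      fun i _ => hp2 i).and (hlim.eventually_ge_atTop 1))).exists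
    have h4 : h ω ≤ ∑ i ∈ Finset.range N, (a i ω).card := by
      have := (Finset.card_le_card h1).trans Finset.card_biUnion_le
      simpa using this
    have h5 : q * h ω ≤ (∑ i ∈ Finset.range N, p i) * h ω := by
      refine (Nat.mul_le_mul_left q h4).trans ?_
      rw [Finset.mul_sum, Finset.sum_mul]
      exact Finset.sum_le_sum fun i hi => (h2 i hi).le
    have h6 : q ≤ ∑ i ∈ Finset.range N, p i := Nat.le_of_mul_le_mul_right h5 h3
    calc (q : ℝ) ≤ ∑ i ∈ Finset.range N, (p i : ℝ) := by exact_mod_cast h6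
      _ ≤ ∑ i ∈ Finset.range N,
          (q * (limitUniverse D hD).stP (natGerm hD h hh) (finGerm hD (a i) (ha i)) + 1) :=
        Finset.sum_le_sum fun i _ => hp1 i
      _ = q * S + N := by simp [Finset.sum_add_distrib, Finset.mul_sum, hS]
  by_contra! hlt
  obtain ⟨q, hq⟩ := exists_nat_gt (N / (1 - S))
  rw [div_lt_iff₀ (by linarith)] at hq
  have hq0 : 0 < q := by
    rcases Nat.eq_zero_or_pos q with rfl | h
    · rw [Nat.cast_zero, zero_mul] at hq
      exact absurd hq (Nat.cast_nonneg N).not_gt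
    · exact h
  have := key q hq0
  nlinarith

/-- A countable family of internal sets covering `Ω` has a finite subfamily covering `Ω`. -/
theorem exists_finite_subcover (a : ℕ → SamplePoint J → Finset ℕ)
    (ha : ∀ i, CountablySupported (a i))
    (hcover : ∀ x ∈ (limitUniverse D hD).Omega (natGerm hD h hh),
      ∃ i, (limitUniverse D hD).Mem x (finGerm hD (a i) (ha i))) :
    ∃ N, ∀ᶠ ω in D, Finset.Icc 1 (h ω) ⊆ (Finset.range N).biUnion fun i => a i ω := by
  by_contra! hcon
  -- The uncovered remainders decrease and, if no finite subfamily covers, are nonempty; saturation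
  -- yields a point of `Ω` outside every set.
  let c : ℕ → ℕ × (ℕ → Finset ℕ) → Finset ℕ := fun N b =>
    Finset.Icc 1 b.1 \ (Finset.range N).biUnion b.2
  have hb : CountablySupported fun ω => (h ω, fun i => a i ω) := hh.prodMk (CountablySupported.pi ha)
  have hanti : ∀ M N b, M ≤ N → c N b ⊆ c M b := fun M N b hMN =>
    Finset.sdiff_subset_sdiff subset_rfl
      (Finset.biUnion_subset_biUnion_of_subset_left _ (Finset.range_mono hMN))
  obtain ⟨x, hx⟩ := limitUniverse_isOmegaOneSaturated
    (fun N => finGerm hD (fun ω => c N (h ω, fun i => a i ω)) (hb.comp (c N))) (by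
    intro F
    let w : ℕ × (ℕ → Finset ℕ) → ℕ := fun b => Classical.epsilon fun k => k ∈ c (F.sup id) b
    refine ⟨natGerm hD _ (hb.comp w), fun i hi => natGerm_mem_finGerm_iff.2 ?_⟩
    have h1 := hcon (F.sup id)
    filter_upwards [h1] with ω h2
    obtain ⟨k, hk1, hk2⟩ := Finset.not_subset.1 h2
    refine hanti i (F.sup id) _ (Finset.le_sup (f := id) hi) ?_
    exact Classical.epsilon_spec (p := fun k => k ∈ c (F.sup id) (h ω, fun i => a i ω))
      ⟨k, Finset.mem_sdiff.2 ⟨hk1, hk2⟩⟩)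
  have hxΩ : x ∈ (limitUniverse D hD).Omega (natGerm hD h hh) :=
    (finGerm_mem_internalSubsets
      (Eventually.of_forall fun ω => Finset.sdiff_subset)).2 x (hx 0)
  obtain ⟨y, hy, rfl, -⟩ := exists_eq_natGerm_of_mem_Omega hxΩ
  obtain ⟨i, hi⟩ := hcover _ hxΩ
  obtain ⟨ω, h1, h2⟩ :=
    ((natGerm_mem_finGerm_iff.1 hi).and (natGerm_mem_finGerm_iff.1 (hx (i + 1)))).exists
  exact (Finset.mem_sdiff.1 h2).2
    (Finset.mem_biUnion.2 ⟨i, Finset.mem_range.2 (Nat.lt_succ_self i), h1⟩)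

/-! ### Total mass of the Loeb outer measure. -/

theorem loebOuter_points_le {U : NonstdUniverse.{u}} {H A : U.Carrier}
    (hA : A ∈ U.InternalSubsets H) :
    U.loebOuter H (U.points H A) ≤ ENNReal.ofReal (U.stP H A) :=
  (OuterMeasure.boundedBy_le _).trans (iInf₂_le_of_le A hA (iInf_le _ rfl))

/-- Up to a total error `ε`, a countable cover of finite cost is replaced by internal sets.
Saturation then reduces it to a finite cover, to which the counting estimate applies. -/
theorem one_le_loebOuter_univ (hlim : Tendsto h D atTop) :
    1 ≤ (limitUniverse D hD).loebOuter (natGerm hD h hh) Set.univ := by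
  rw [NonstdUniverse.loebOuter, OuterMeasure.boundedBy_apply]
  refine le_iInf₂ fun t ht => ?_
  refine ENNReal.le_of_forall_pos_le_add fun ε hε hfin => ?_
  obtain ⟨δ, hδ, hδsum⟩ := ENNReal.exists_pos_sum_of_countable
    (ε := (ε : ℝ≥0∞)) (by exact_mod_cast hε.ne') ℕ
  have hex : ∀ n, ∃ (a : SamplePoint J → Finset ℕ) (ha : CountablySupported a),
      (∀ᶠ ω in D, a ω ⊆ Finset.Icc 1 (h ω)) ∧
      t n ⊆ (limitUniverse D hD).points (natGerm hD h hh) (finGerm hD a ha) ∧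
      ENNReal.ofReal ((limitUniverse D hD).stP (natGerm hD h hh) (finGerm hD a ha)) ≤
        (⨆ _ : (t n).Nonempty, (limitUniverse D hD).preMeasure (natGerm hD h hh) (t n)) + δ n := by
    intro n
    rcases (t n).eq_empty_or_nonempty with he | hne
    -- `boundedBy` charges nothing for an empty piece, so the internal empty set stands in for it.
    · refine ⟨fun _ => ∅, CountablySupported.const _, by simp, by simp [he], ?_⟩
      rw [stP_finGerm_eq_zero hlim (by simp)]
      simp
    · have hlt : (limitUniverse D hD).preMeasure (natGerm hD h hh) (t n) <
          (limitUniverse D hD).preMeasure (natGerm hD h hh) (t n) + δ n := by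
        refine ENNReal.lt_add_right ?_ (by exact_mod_cast (hδ n).ne')
        have := ENNReal.ne_top_of_tsum_ne_top hfin.ne n
        simpa [hne] using this
      nth_rewrite 1 [NonstdUniverse.preMeasure] at hlt
      simp only [iInf_lt_iff] at hlt
      obtain ⟨A, hA, hpts, hlt⟩ := hlt
      obtain ⟨a, ha, rfl, hsub⟩ := exists_eq_finGerm hA
      refine ⟨a, ha, hsub, hpts.ge, ?_⟩
      simp only [hne, ciSup_pos]
      exact hlt.le
  choose a ha hsub hpts hle using hex
  obtain ⟨N, hN⟩ := exists_finite_subcover (hD := hD) (hh := hh) a ha (by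
    intro x hx
    obtain ⟨i, hi⟩ := Set.mem_iUnion.1 (ht (Set.mem_univ (⟨x, hx⟩ : (limitUniverse D hD).Omega _)))
    exact ⟨i, hpts i hi⟩)
  have h1 := one_le_sum_stP (hD := hD) (hh := hh) hlim a ha hsub N hN
  calc (1 : ℝ≥0∞) = ENNReal.ofReal 1 := by simp
    _ ≤ ENNReal.ofReal (∑ i ∈ Finset.range N,
          (limitUniverse D hD).stP (natGerm hD h hh) (finGerm hD (a i) (ha i))) :=
        ENNReal.ofReal_le_ofReal h1
    _ = ∑ i ∈ Finset.range N, ENNReal.ofReal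
          ((limitUniverse D hD).stP (natGerm hD h hh) (finGerm hD (a i) (ha i))) :=
        ENNReal.ofReal_sum_of_nonneg fun _ _ => stP_finGerm_nonneg
    _ ≤ ∑ i ∈ Finset.range N,
          ((⨆ _ : (t i).Nonempty, (limitUniverse D hD).preMeasure (natGerm hD h hh) (t i)) + δ i) :=
        Finset.sum_le_sum fun i _ => hle i
    _ ≤ ∑' i, ((⨆ _ : (t i).Nonempty,
          (limitUniverse D hD).preMeasure (natGerm hD h hh) (t i)) + δ i) := ENNReal.sum_le_tsum _
    _ ≤ _ := by
        rw [ENNReal.tsum_add]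
        exact add_le_add_right hδsum.le _

theorem loebOuter_univ_ne_top :
    (limitUniverse D hD).loebOuter (natGerm hD h hh) Set.univ ≠ ⊤ := by
  have h1 : finGerm hD (fun ω => Finset.Icc 1 (h ω)) (hh.comp _) ∈
      (limitUniverse D hD).InternalSubsets (natGerm hD h hh) :=
    finGerm_mem_internalSubsets (Eventually.of_forall fun ω => subset_rfl)
  have h2 : (limitUniverse D hD).points (natGerm hD h hh)
      (finGerm hD (fun ω => Finset.Icc 1 (h ω)) (hh.comp _)) = Set.univ := by
    refine Set.eq_univ_of_forall ?_
    rintro ⟨x, hx⟩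
    obtain ⟨y, hy, rfl, hyh⟩ := exists_eq_natGerm_of_mem_Omega hx
    exact (natGerm_mem_finGerm_iff (hy := hy)).2 hyh
  have h3 := loebOuter_points_le h1
  rw [h2] at h3
  exact ne_top_of_le_ne_top ENNReal.ofReal_ne_top h3

theorem measurableSet_caratheodory_of_null {X : Type*} (m : OuterMeasure X) {s : Set X}
    (hs : m s = 0) : MeasurableSet[m.caratheodory] s := by
  rw [OuterMeasure.isCaratheodory_iff_le]
  intro t
  rw [measure_mono_null Set.inter_subset_right hs, zero_add]
  exact measure_mono Set.sdiff_subset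

/-! ### Noncompactness and cardinality of `Ω`. -/

variable [LinearOrder J]

/-- The conclusion of `exists_capturing_ultrafilter`. -/
def IsCapturing (D : Ultrafilter (SamplePoint J)) : Prop :=
  ∀ (j : J) (x h : SamplePoint J → ℕ) (n : ℕ), SupportedOn x (Set.Iio j) →
    SupportedOn h (Set.Iio j) → Tendsto h D atTop →
    ∀ᶠ ω in D, x ω ∈ ω.2 j (h ω) ∧ n * (ω.2 j (h ω)).card ≤ h ω

theorem not_isCompactMeasure_loebMeasure {K : Type u} [LinearOrder K] [WellFoundedLT K]
    (hK : IsContinuumSuccLike K) (hcap : IsCapturing D)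
    (hJ : ∀ s : Set J, s.Countable → ∃ b, ∀ j ∈ s, j < b)
    (e : K → J) (he : ∀ j, ∃ γ, ∀ α, γ ≤ α → j ≤ e α) (hlim : Tendsto h D atTop) :
    ¬ IsCompactMeasure ((limitUniverse D hD).loebMeasure (natGerm hD h hh)) := by
  obtain ⟨b, hb⟩ := hh.supportedOn_Iio hJ
  obtain ⟨γ₀, hγ₀⟩ := he b
  -- The maximum with `γ₀` places the index beyond the support of `h`, so that capture applies for
  -- every `α`. Smallness makes the sets null; capture puts each point in all late ones.
  let E : K → SamplePoint J → Finset ℕ := fun α ω =>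
    ω.2 (e (max α γ₀)) (h ω) ∩ Finset.Icc 1 (h ω)
  have hE : ∀ α, CountablySupported (E α) := fun α =>
    (CountablySupported.coord (e (max α γ₀))).comp₂ hh fun z m => z m ∩ Finset.Icc 1 m
  have hbE : ∀ α, SupportedOn h (Set.Iio (e (max α γ₀))) := fun α =>
    hb _ (hγ₀ _ (le_max_right α γ₀))
  let P : K → Set ((limitUniverse D hD).Omega (natGerm hD h hh)) := fun α =>
    (limitUniverse D hD).points (natGerm hD h hh) (finGerm hD (E α) (hE α))
  have hnull : ∀ α, (limitUniverse D hD).loebOuter (natGerm hD h hh) (P α) = 0 := by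
    intro α
    have h1 := loebOuter_points_le (finGerm_mem_internalSubsets (hD := hD) (hh := hh) (ha := hE α)
      (Eventually.of_forall fun ω => Finset.inter_subset_right))
    rw [stP_finGerm_eq_zero hlim, ENNReal.ofReal_zero] at h1
    · exact le_antisymm h1 zero_le
    · intro n
      filter_upwards [hcap (e (max α γ₀)) h h n (hbE α) (hbE α) hlim] with ω h2
      exact (Nat.mul_le_mul_left n (Finset.card_le_card Finset.inter_subset_left)).trans h2.2
  have hmeas : ∀ α, MeasurableSet[(limitUniverse D hD).loebSpace (natGerm hD h hh)] (P α) :=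
    fun α => measurableSet_caratheodory_of_null _ (hnull α)
  have happ : ∀ s, MeasurableSet[(limitUniverse D hD).loebSpace (natGerm hD h hh)] s →
      (limitUniverse D hD).loebMeasure (natGerm hD h hh) s =
        (limitUniverse D hD).loebOuter (natGerm hD h hh) s := fun s hs =>
    @toMeasure_apply _ ((limitUniverse D hD).loebSpace (natGerm hD h hh)) _ _ _ hs
  have huniv := happ Set.univ (@MeasurableSet.univ _ (_))
  have hfinite : @IsFiniteMeasure _ ((limitUniverse D hD).loebSpace (natGerm hD h hh))
      ((limitUniverse D hD).loebMeasure (natGerm hD h hh)) :=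
    @IsFiniteMeasure.mk _ (_) _ (by rw [huniv]; exact loebOuter_univ_ne_top.lt_top)
  refine @not_isCompactMeasure_of_null_cover _ K _ _ hK
    ((limitUniverse D hD).loebSpace (natGerm hD h hh)) _ hfinite ?_ P hmeas ?_ ?_
  · rw [huniv]
    exact (zero_lt_one.trans_le (one_le_loebOuter_univ hlim)).ne'
  · intro α
    rw [happ _ (hmeas α), hnull α]
  · rintro ⟨x, hx⟩
    obtain ⟨y, hy, rfl, hyh⟩ := exists_eq_natGerm_of_mem_Omega hx
    obtain ⟨c, hc⟩ := hy.supportedOn_Iio hJ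
    obtain ⟨γ, hγ⟩ := he c
    refine ⟨γ, fun α hα => (natGerm_mem_finGerm_iff (hy := hy)).2 ?_⟩
    filter_upwards [hyh, hcap (e (max α γ₀)) y h 0
      (hc _ (hγ _ (hα.trans (le_max_left α γ₀)))) (hbE α) hlim] with ω h1 h2
    exact Finset.mem_inter.2 ⟨h2.1, h1⟩

/-- For each `j` beyond the support of `h`, pick `y j` in `Ω` outside the `j`-th captured set. That
set contains all earlier `y i`, so the points `y j` are distinct. -/
theorem le_mk_Omega (hcap : IsCapturing D)
    (hJ : ∀ s : Set J, s.Countable → ∃ b, ∀ j ∈ s, j < b) {c : Cardinal.{u}}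
    (hc : ∀ b : J, c ≤ #(Set.Ici b)) (hlim : Tendsto h D atTop) :
    c ≤ #((limitUniverse D hD).Omega (natGerm hD h hh)) := by
  obtain ⟨b, hb⟩ := hh.supportedOn_Iio hJ
  let w : (ℕ → Finset ℕ) → ℕ → ℕ := fun z m => Classical.epsilon fun k => k ∈ Finset.Icc 1 m \ z m
  let y : J → SamplePoint J → ℕ := fun j ω => w (ω.2 j) (h ω)
  have hy : ∀ j, CountablySupported (y j) := fun j => (CountablySupported.coord j).comp₂ hh w
  have hspec : ∀ j, b ≤ j → ∀ᶠ ω in D, y j ω ∈ Finset.Icc 1 (h ω) \ ω.2 j (h ω) := by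
    intro j hj
    -- The factor `2` leaves at least half of `{1, …, h}` uncaptured.
    filter_upwards [hcap j h h 2 (hb j hj) (hb j hj) hlim, hlim.eventually_ge_atTop 1]
      with ω h1 h2
    refine Classical.epsilon_spec (p := fun k => k ∈ Finset.Icc 1 (h ω) \ ω.2 j (h ω)) ?_
    refine Finset.card_pos.1 ?_
    have h3 := Finset.le_card_sdiff (ω.2 j (h ω)) (Finset.Icc 1 (h ω))
    rw [Nat.card_Icc] at h3
    omega
  have hsupp : ∀ i j, b ≤ i → i < j → SupportedOn (y i) (Set.Iio j) := by
    intro i j hi hij x x' h1 h2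
    have h3 : h x = h x' := hb j (hi.trans hij.le) x x' h1 h2
    have h4 : x.2 i = x'.2 i := h2 i hij
    simp only [y, h3, h4]
  refine (hc b).trans (Cardinal.mk_le_of_injective (f := fun j : Set.Ici b =>
    (⟨natGerm hD (y j) (hy j), natGerm_mem_Omega_iff.2 ((hspec j j.2).mono fun ω h1 =>
      (Finset.mem_sdiff.1 h1).1)⟩ : (limitUniverse D hD).Omega (natGerm hD h hh))) ?_)
  have hne : ∀ i j, b ≤ i → i < j → natGerm hD (y i) (hy i) ≠ natGerm hD (y j) (hy j) := by
    intro i j hi hij heq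
    have hj := hi.trans hij.le
    obtain ⟨ω, h1, h2, h3⟩ := ((natGerm_eq_iff.1 heq).and ((hspec j hj).and
      (hcap j (y i) h 0 (hsupp i j hi hij) (hb j hj) hlim))).exists
    exact (Finset.mem_sdiff.1 h2).2 (h1 ▸ h3.1)
  intro i j hij
  have hij' := congrArg Subtype.val hij
  rcases lt_trichotomy i.1 j.1 with hlt | heq | hlt
  · exact absurd hij' (hne _ _ i.2 hlt)
  · exact Subtype.ext heq
  · exact absurd hij'.symm (hne _ _ j.2 hlt)

end Loeb

/-- Functions with countable support number at most `c ^ ℵ₀` times `|V| ^ 𝔠`, and `|V| ^ 𝔠 ≤ 2 ^ |V|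
≤ |V| ^ ℵ₀ ≤ c ^ ℵ₀ = c`. -/
theorem mk_Omega_le {J : Type u} [Nonempty J] {D : Ultrafilter (SamplePoint J)}
    {hD : Filter.Tendsto Prod.fst (D : Filter (SamplePoint J)) Filter.atTop} {c : Cardinal.{u}}
    (hJ : #J ≤ c) (hc : c ^ ℵ₀ = c) (hV : Cardinal.lift.{u} #StdUniverse < c)
    (H : (limitUniverse D hD).Carrier) : #((limitUniverse D hD).Omega H) ≤ c := by
  have h0 : ℵ₀ ≤ #StdUniverse := aleph0_le_continuum.trans StdUniverse.continuum_le
  have h0c : ℵ₀ ≤ c := by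
    have := Cardinal.lift_le.{u}.2 h0
    rw [Cardinal.lift_aleph0] at this
    exact this.trans hV.le
  have h1 : #StdUniverse ^ (𝔠 : Cardinal.{0}) ≤ #StdUniverse ^ ℵ₀ := by
    refine (Cardinal.power_le_power_left (Cardinal.mk_ne_zero _) StdUniverse.continuum_le).trans ?_
    rw [Cardinal.power_self_eq h0]
    exact StdUniverse.two_pow_le
  have h2 : Cardinal.lift.{u} (#StdUniverse ^ (𝔠 : Cardinal.{0})) ≤ c := by
    refine (Cardinal.lift_le.2 h1).trans ?_
    rw [Cardinal.lift_power, Cardinal.lift_aleph0]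
    exact (Cardinal.power_le_power_right hV.le).trans hc.le
  have h3 : #{f : SamplePoint J → StdUniverse // CountablySupported f} ≤ c :=
    (CountablySupported.mk_le J StdUniverse).trans
      ((mul_le_mul' ((Cardinal.power_le_power_right hJ).trans hc.le) h2).trans
        (Cardinal.mul_eq_self h0c).le)
  refine (Cardinal.mk_set_le _).trans (le_trans ?_ h3)
  choose f hf hxf using fun x : (limitUniverse D hD).Carrier => exists_eq_germ x
  refine Cardinal.mk_le_of_injective (f := fun x => ⟨f x, (hf x).1⟩) fun x y hxy => ?_
  have h4 : f x = f y := congrArg Subtype.val hxy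
  rw [hxf x, hxf y, germ_eq_iff, h4]
  exact Filter.Eventually.of_forall fun _ => rfl

theorem theorem13 (lam : Cardinal.{u}) (h_large : Cardinal.lift.{u} #StdUniverse < lam)
    (h_pow : lam ^ ℵ₀ = lam) :
    ∃ U : NonstdUniverse.{u}, U.IsOmegaOneSaturated ∧
      ∀ H : U.Carrier, U.IsHyperfinite H →
        #(U.Omega H) = lam ∧ ¬ IsCompactMeasure (U.loebMeasure H) := by
  have hcont : (𝔠 : Cardinal.{u}) < lam := by
    have := Cardinal.lift_le.{u}.2 StdUniverse.continuum_le
    rw [Cardinal.lift_continuum] at this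
    exact this.trans_lt h_large
  have hinf : ℵ₀ ≤ lam := aleph0_le_continuum.trans hcont.le
  let K : Type u := (Order.succ (𝔠 : Cardinal.{u})).ord.ToType
  let L : Type u := lam.ord.ToType
  have hL : #L = lam := Cardinal.mk_ord_toType lam
  have hK : IsContinuumSuccLike K := isContinuumSuccLike_toType
  have hLne : Nonempty L := Cardinal.mk_ne_zero_iff.1 (by
    rw [hL]; exact (aleph0_pos.trans_le hinf).ne')
  obtain ⟨l₀⟩ := hLne
  have hKbound : ∀ α : K, ∃ β, α < β := fun α => by
    obtain ⟨β, hβ⟩ := hK.exists_bound {α} (by simpa using one_lt_aleph0.le.trans aleph0_le_continuum)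
    exact ⟨β, hβ α rfl⟩
  -- The dominant factor `K` bounds countable sets and gives a cofinal copy of `𝔠⁺`; each fibre over
  -- `K` contributes `λ` indices above any earlier point.
  let J : Type u := K ×ₗ L
  obtain ⟨α₀, -⟩ := hK.exists_bound ∅ (by simp)
  have : Nonempty J := ⟨toLex (α₀, l₀)⟩
  have hJcard : #J ≤ lam := by
    have h1 : #J = #K * #L := by
      rw [show #J = #(K × L) from rfl, Cardinal.mk_prod, Cardinal.lift_id, Cardinal.lift_id]
    rw [h1, hL, Cardinal.mk_ord_toType]
    exact (mul_le_mul_left (Order.succ_le_of_lt hcont) lam).trans (Cardinal.mul_eq_self hinf).le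
  have hJ : ∀ s : Set J, s.Countable → ∃ b, ∀ j ∈ s, j < b := by
    intro s hs
    obtain ⟨β, hβ⟩ := hK.exists_bound ((fun j : J => (ofLex j).1) '' s)
      ((Cardinal.le_aleph0_iff_set_countable.2 (hs.image _)).trans aleph0_le_continuum)
    exact ⟨toLex (β, l₀), fun j hj => Prod.Lex.lt_iff.2 (Or.inl (hβ _ ⟨j, hj, rfl⟩))⟩
  have hIci : ∀ b : J, lam ≤ #(Set.Ici b) := by
    intro b
    obtain ⟨β, hβ⟩ := hKbound (ofLex b).1
    have hlt : ∀ l : L, b < toLex (β, l) := fun l => Prod.Lex.lt_iff.2 (Or.inl hβ)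
    refine hL.symm.le.trans (Cardinal.mk_le_of_injective (f := fun l : L =>
      (⟨toLex (β, l), (hlt l).le⟩ : Set.Ici b)) fun l l' hll => ?_)
    exact congrArg (fun j : Set.Ici b => (ofLex j.1).2) hll
  have he : ∀ j : J, ∃ γ : K, ∀ α, γ ≤ α → j ≤ toLex (α, l₀) := by
    intro j
    obtain ⟨β, hβ⟩ := hKbound (ofLex j).1
    refine ⟨β, fun α hα => ?_⟩
    have hlt : j < toLex (α, l₀) := Prod.Lex.lt_iff.2 (Or.inl (hβ.trans_le hα))
    exact hlt.le
  obtain ⟨D, hD, hcap⟩ := exists_capturing_ultrafilter J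
  refine ⟨limitUniverse D hD, limitUniverse_isOmegaOneSaturated, fun H hH => ?_⟩
  obtain ⟨h, hh, rfl, hlim⟩ := IsHyperfinite.exists_eq_natGerm hH
  exact ⟨le_antisymm (mk_Omega_le hJcard h_pow h_large _) (le_mk_Omega hcap hJ hIci hlim),
    not_isCompactMeasure_loebMeasure hK hcap hJ (fun α => toLex (α, l₀)) he hlim⟩
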